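/- Conventions. Let $R$ be a commutative Noetherian ring. A projective Noetherian $R$-algebra is an associative unital $R$-algebra which is finitely generated and projective as an $R$-module. $A\text{-mod}$ and $\text{mod-}A$ are the categories of finitely generated left and right $A$-modules, $R\text{-proj}$ is the category of finitely generated projective $R$-modules, $D=\operatorname{Hom}_R(-,R)$, and $\operatorname{add}M$ is the class of direct summands of finite direct sums of copies of $M$. An exact sequence of $A$-modules is $(A,R)$-exact if it splits as a sequence of $R$-modules (that is, it has $R$-linear maps giving a contracting homotopy at each place where exactness is required). The multiplication of $\operatorname{End}_A(M)$ is composition of maps. For $M\in A\text{-mod}\cap R\text{-proj}$ write $M\text{-domdim}(A,R)\ge 2$ if there is an $(A,R)$-exact sequence $0\to A\to M_1\to M_2$ with $M_1,M_2\in\operatorname{add}M$ such that $\operatorname{Hom}_A(M_2,M)\to\operatorname{Hom}_A(M_1,M)\to\operatorname{Hom}_A(A,M)\to 0$ is exact. For a projective Noetherian $R$-algebra $B$ and an integer $n\ge 0$, a module $M\in\text{mod-}B\cap R\text{-proj}$ is an $n$-quasi-generator of $\text{mod-}B$ if $M\otimes_B DM\in R\text{-proj}$ and $n$ is the least non-negative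 integer for which there is a $(B,R)$-exact sequence of right $B$-modules $0\to B\to M_0\to\cdots\to M_n\to 0$ with all $M_i\in\operatorname{add}M$ that remains exact under $\operatorname{Hom}_B(-,M)$. The projective dimension $\operatorname{pdim}_A M$ is the least integer $k\ge 0$ such that $M$ has a projective resolution of length at most $k$ (so $\operatorname{pdim}_A 0=0$). Two pairs $(A,M)$, $(A',M')$, each consisting of an $R$-algebra and a module over it on the same fixed side, are isomorphic if there are an $R$-algebra isomorphism $\varphi:A\to A'$ and an additive isomorphism $\psi:M\to M'$ which is compatible with the actions via $\varphi$. Theorem. Let $R$ be a commutative Noetherian ring and $n\ge 0$ an integer. Let $\Gamma$ be the class of isomorphism classes of pairs $(B,M)$ where $B$ is a projective Noetherian $R$-algebra and $M$ is an $n$-quasi-generator of $\text{mod-}B$. Let $\Lambda$ be the class of isomorphism classes of pairs $(A,M)$ where $A$ is a projective Noetherian $R$-algebra and $M\in A\text{-mod}\cap R\text{-proj}$ satisfies $$M\text{-domdim}(A,R)\ge 2,\quad \operatorname{pdim}_A M=n,\quad DM\otimes_A M\in R\text{-proj},\quad \operatorname{Tor}_i^A(DM,M)=0\ \text{ for all }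 i>0.$$ Then the assignments $\Phi:(B,M)\mapsto(\operatorname{End}_B(M),M)$ and $\Psi:(A,M)\mapsto(\operatorname{End}_A(M)^{op},M)$ define mutually inverse bijections $\Phi:\Gamma\to\Lambda$ and $\Psi:\Lambda\to\Gamma$. Moreover, if $R$ is a field, then for every finite-dimensional $R$-algebra $A$ and every finitely generated left $A$-module $M$, the conditions $DM\otimes_A M\in R\text{-proj}$ and $\operatorname{Tor}_i^A(DM,M)=0$ for all $i>0$ hold together if and only if $M$ is self-orthogonal, that is, $\operatorname{Ext}_A^i(M,M)=0$ for all $i>0$. -/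

import Mathlib

open CategoryTheory TensorProduct MulOpposite

universe u

namespace QuasiGen

/-! ## Modules over `R`-algebras

A left module over an `R`-algebra `A` is `[Module A M]` together with the induced `R`-module
structure `[Module R M] [IsScalarTower R A M]`. A right `B`-module is a module over `Bᵐᵒᵖ`,
so that `m * b` is written `op b • m`. -/

/-- `X ∈ R-proj`: a finitely generated projective module. -/
def FGProj (R X : Type u) [Ring R] [AddCommGroup X] [Module R X] : Prop :=
  Module.Finite R X ∧ Module.Projective R X

/-- `X ∈ add_A Q`: `X` is a direct summand of a finite direct sum of copies of `Q`. -/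
def InAdd (A Q X : Type u) [Ring A] [AddCommGroup Q] [Module A Q]
    [AddCommGroup X] [Module A X] : Prop :=
  ∃ (k : ℕ) (i : X →ₗ[A] (Fin k → Q)) (p : (Fin k → Q) →ₗ[A] X), p ∘ₗ i = LinearMap.id

/-! ## The standard duality -/

/-- The standard dual `D M = Hom_R(M, R)`. -/
def StdDual (R M : Type u) [CommRing R] [AddCommGroup M] [Module R M] : Type u := M →ₗ[R] R

namespace StdDual

variable {R A B M : Type u} [CommRing R] [AddCommGroup M] [Module R M]

instance : AddCommGroup (StdDual R M) := inferInstanceAs (AddCommGroup (M →ₗ[R] R))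

instance : Module R (StdDual R M) := inferInstanceAs (Module R (M →ₗ[R] R))

instance : FunLike (StdDual R M) M R := inferInstanceAs (FunLike (M →ₗ[R] R) M R)

@[ext] theorem ext {f g : StdDual R M} (h : ∀ m, f m = g m) : f = g := LinearMap.ext h

/-- The dual of a left `A`-module is a right `A`-module, by `(f * a) m = f (a m)`. -/
instance rightModule [Ring A] [Algebra R A] [Module A M] [IsScalarTower R A M] :
    Module Aᵐᵒᵖ (StdDual R M) where
  smul a f := LinearMap.comp f (Algebra.lsmul R R M a.unop)
  one_smul f := ext fun m => congrArg f (one_smul A m)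
  mul_smul a b f := ext fun m => congrArg f (mul_smul b.unop a.unop m)
  smul_zero _ := rfl
  smul_add _ _ _ := rfl
  add_smul a b f := ext fun m =>
    (congrArg f (add_smul a.unop b.unop m)).trans (LinearMap.map_add f _ _)
  zero_smul f := ext fun m => (congrArg f (zero_smul A m)).trans (LinearMap.map_zero f)

/-- The dual of a right `B`-module is a left `B`-module, by `(b f) m = f (m * b)`. -/
instance leftModule [Ring B] [Algebra R B] [Module Bᵐᵒᵖ M] [IsScalarTower R Bᵐᵒᵖ M] :
    Module B (StdDual R M) where
  smul b f := LinearMap.comp f (Algebra.lsmul R R M (op b))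
  one_smul f := ext fun m => congrArg f (one_smul Bᵐᵒᵖ m)
  mul_smul a b f := ext fun m => congrArg f (mul_smul (op b) (op a) m)
  smul_zero _ := rfl
  smul_add _ _ _ := rfl
  add_smul a b f := ext fun m =>
    (congrArg f (add_smul (op a) (op b) m)).trans (LinearMap.map_add f _ _)
  zero_smul f := ext fun m => (congrArg f (zero_smul Bᵐᵒᵖ m)).trans (LinearMap.map_zero f)

theorem op_smul_apply [Ring A] [Algebra R A] [Module A M] [IsScalarTower R A M]
    (a : A) (f : StdDual R M) (m : M) : (op a • f) m = f (a • m) := rfl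

theorem smul_apply_right [Ring B] [Algebra R B] [Module Bᵐᵒᵖ M] [IsScalarTower R Bᵐᵒᵖ M]
    (b : B) (f : StdDual R M) (m : M) : (b • f) m = f (op b • m) := rfl

end StdDual

/-! ## Tensor products over a noncommutative ring, and `Tor` -/

section Tensor

variable (R A : Type u) [CommRing R] [Ring A]
variable (N : Type u) [AddCommGroup N] [Module R N] [Module Aᵐᵒᵖ N]

/-- The relations `(n * a) ⊗ m = n ⊗ (a m)` defining `N ⊗_A M` as a quotient of `N ⊗_ℤ M`. -/
def balancedRel (M : Type u) [AddCommGroup M] [Module A M] : Submodule R (N ⊗[ℤ] M) :=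
  Submodule.span R
    {t | ∃ (n : N) (a : A) (m : M), t = (op a • n) ⊗ₜ[ℤ] m - n ⊗ₜ[ℤ] (a • m)}

/-- `N ⊗_A M` for a right `A`-module `N` and a left `A`-module `M`, with the `R`-module structure
coming from `N`. -/
abbrev BalTensor (M : Type u) [AddCommGroup M] [Module A M] : Type u :=
  (N ⊗[ℤ] M) ⧸ balancedRel R A N M

/-- The map `N ⊗_A M → N ⊗_A M'` induced by an `A`-linear map `M → M'`. -/
noncomputable def BalTensor.map {M M' : Type u} [AddCommGroup M] [Module A M]
    [AddCommGroup M'] [Module A M'] (f : M →ₗ[A] M') :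
    BalTensor R A N M →ₗ[R] BalTensor R A N M' :=
  Submodule.mapQ _ _
    (TensorProduct.AlgebraTensorModule.map (LinearMap.id : N →ₗ[R] N) (f.restrictScalars ℤ)) (by
      refine Submodule.span_le.2 ?_
      rintro _ ⟨n, a, m, rfl⟩
      refine Submodule.subset_span ⟨n, a, f m, ?_⟩
      simp)

theorem BalTensor.map_mk_tmul {M M' : Type u} [AddCommGroup M] [Module A M]
    [AddCommGroup M'] [Module A M'] (f : M →ₗ[A] M') (n : N) (m : M) :
    BalTensor.map R A N f (Submodule.Quotient.mk (n ⊗ₜ[ℤ] m)) =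
      Submodule.Quotient.mk (n ⊗ₜ[ℤ] f m) := rfl

theorem BalTensor.hom_ext {M X : Type u} [AddCommGroup M] [Module A M] [AddCommGroup X]
    [Module R X] {f g : BalTensor R A N M →ₗ[R] X}
    (h : ∀ n m, f (Submodule.Quotient.mk (n ⊗ₜ[ℤ] m)) = g (Submodule.Quotient.mk (n ⊗ₜ[ℤ] m))) :
    f = g := by
  refine Submodule.linearMap_qext _ (LinearMap.ext fun t => ?_)
  induction t with
  | zero => simp
  | tmul n m => exact h n m
  | add x y hx hy => rw [map_add, map_add, hx, hy]

/-- The functor `N ⊗_A - : A-Mod ⥤ R-Mod`. -/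
noncomputable def tensorFunctor : ModuleCat.{u} A ⥤ ModuleCat.{u} R where
  obj M := ModuleCat.of R (BalTensor R A N M)
  map f := ModuleCat.ofHom (BalTensor.map R A N f.hom)
  map_id _ := ModuleCat.hom_ext (BalTensor.hom_ext R A N fun _ _ => rfl)
  map_comp _ _ := ModuleCat.hom_ext (BalTensor.hom_ext R A N fun _ _ => rfl)

instance : (tensorFunctor R A N).Additive where
  map_add := ModuleCat.hom_ext (BalTensor.hom_ext R A N fun n _ =>
    (congrArg Submodule.Quotient.mk (TensorProduct.tmul_add n _ _)).trans
      (Submodule.Quotient.mk_add _))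

/-- `Tor_i^A(N, M)`, the `i`-th left derived functor of `N ⊗_A -` at `M`. -/
noncomputable def TorMod (i : ℕ) (M : Type u) [AddCommGroup M] [Module A M] : ModuleCat.{u} R :=
  ((tensorFunctor R A N).leftDerived i).obj (ModuleCat.of A M)

end Tensor

/-! ## Relative exact sequences and relative dominant dimension -/

/-- A sequence `X 0 → X 1 → X 2 → ⋯` of modules over an `R`-algebra `A`. -/
structure ModSeq (R A : Type u) [CommRing R] [Ring A] [Algebra R A] where
  X : ℕ → Type u
  [grp : ∀ i, AddCommGroup (X i)]
  [modR : ∀ i, Module R (X i)]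
  [modA : ∀ i, Module A (X i)]
  [tower : ∀ i, IsScalarTower R A (X i)]
  d : ∀ i, X i →ₗ[A] X (i + 1)

attribute [instance] ModSeq.grp ModSeq.modR ModSeq.modA ModSeq.tower

namespace ModSeq

variable {R A : Type u} [CommRing R] [Ring A] [Algebra R A] (S : ModSeq R A)

/-- `0 → X 0 → X 1 → ⋯ → X n` is exact (at `X 0, …, X (n - 1)`). -/
def ExactTo (n : ℕ) : Prop :=
  (0 < n → Function.Injective (S.d 0)) ∧
    ∀ i, i + 1 < n → Function.Exact (S.d i) (S.d (i + 1))

/-- `0 → X 0 → X 1 → ⋯ → X n` splits as a sequence of `R`-modules: there is an `R`-linear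
contracting homotopy at `X 0, …, X (n - 1)`. -/
def SplitTo (n : ℕ) : Prop :=
  ∃ h : ∀ i, S.X (i + 1) →ₗ[R] S.X i,
    (0 < n → ∀ x, h 0 (S.d 0 x) = x) ∧
      ∀ i, i + 1 < n → ∀ x, S.d i (h i x) + h (i + 1) (S.d (i + 1) x) = x

/-- `Hom_A(X n, Q) → ⋯ → Hom_A(X 1, Q) → Hom_A(X 0, Q) → 0` is exact
(at `Hom_A(X i, Q)` for `i < n`). -/
def HomExactTo (Q : Type u) [AddCommGroup Q] [Module A Q] (n : ℕ) : Prop :=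
  (0 < n → Function.Surjective fun g : S.X 1 →ₗ[A] Q => g ∘ₗ S.d 0) ∧
    ∀ i, i + 1 < n →
      Function.Exact (fun g : S.X (i + 2) →ₗ[A] Q => g ∘ₗ S.d (i + 1))
        (fun g : S.X (i + 1) →ₗ[A] Q => g ∘ₗ S.d i)

/-- `0 → M → Q₁ → ⋯ → Qₙ` (with `M = X 0` and `Qᵢ = X i`) is an `(A, R)`-exact sequence with
`Qᵢ ∈ add_A Q` which remains exact under `Hom_A(-, Q)`. -/
def IsAddCopres (Q M : Type u) [AddCommGroup Q] [Module A Q] [AddCommGroup M] [Module A M]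
    (n : ℕ) : Prop :=
  Nonempty (M ≃ₗ[A] S.X 0) ∧ (∀ i, i < n → InAdd A Q (S.X (i + 1))) ∧
    S.ExactTo n ∧ S.SplitTo n ∧ S.HomExactTo Q n

end ModSeq

section Invariants

variable (R A : Type u) [CommRing R] [Ring A] [Algebra R A]
variable (Q M : Type u) [AddCommGroup Q] [Module A Q] [AddCommGroup M] [Module A M]

/-- `Q-domdim_{(A, R)} M ≥ n`. -/
def DomDimGE (n : ℕ) : Prop :=
  ∃ S : ModSeq R A, S.IsAddCopres Q M n

/-- There is an `(A, R)`-exact sequence `0 → M → M₀ → ⋯ → Mₙ → 0` with `Mᵢ ∈ add_A Q` which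
remains exact under `Hom_A(-, Q)`. Here `M = X 0`, `Mᵢ = X (i + 1)` and `X (n + 2) = 0`. -/
def HasAddCores (n : ℕ) : Prop :=
  ∃ S : ModSeq R A, S.IsAddCopres Q M (n + 2) ∧ Subsingleton (S.X (n + 2))

/-- `pdim_A M = n`: the least natural number `k` such that `M` has projective dimension at most
`k` is `n` (in particular the zero module has projective dimension `0`). -/
def PDimEq (n : ℕ) : Prop :=
  IsLeast {k : ℕ | HasProjectiveDimensionLE (ModuleCat.of A M) k} n

/-- `A` is a projective Noetherian `R`-algebra (over a Noetherian ring `R`). -/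
abbrev IsProjNoetherianAlg : Prop := FGProj R A

end Invariants

/-- The right `B`-module `M` is an `n`-quasi-generator of `mod-B`. -/
def IsQuasiGenerator (R B M : Type u) [CommRing R] [Ring B] [Algebra R B] [AddCommGroup M]
    [Module R M] [Module Bᵐᵒᵖ M] [IsScalarTower R Bᵐᵒᵖ M] (n : ℕ) : Prop :=
  Module.Finite Bᵐᵒᵖ M ∧ FGProj R M ∧ FGProj R (BalTensor R B M (StdDual R M)) ∧
    IsLeast {k : ℕ | HasAddCores R Bᵐᵒᵖ M B k} n

/-! ## Pairs consisting of an algebra and a module -/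

/-- A pair `(B, M)` of an `R`-algebra `B` and a right `B`-module `M`. -/
structure RightPair (R : Type u) [CommRing R] where
  B : Type u
  M : Type u
  [ringB : Ring B]
  [algB : Algebra R B]
  [grpM : AddCommGroup M]
  [modR : Module R M]
  [modB : Module Bᵐᵒᵖ M]
  [tower : IsScalarTower R Bᵐᵒᵖ M]

attribute [instance] RightPair.ringB RightPair.algB RightPair.grpM RightPair.modR
  RightPair.modB RightPair.tower

/-- A pair `(A, M)` of an `R`-algebra `A` and a left `A`-module `M`. -/
structure LeftPair (R : Type u) [CommRing R] where
  A : Type u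
  M : Type u
  [ringA : Ring A]
  [algA : Algebra R A]
  [grpM : AddCommGroup M]
  [modR : Module R M]
  [modA : Module A M]
  [tower : IsScalarTower R A M]

attribute [instance] LeftPair.ringA LeftPair.algA LeftPair.grpM LeftPair.modR
  LeftPair.modA LeftPair.tower

variable {R : Type u} [CommRing R]

/-- `B` is a projective Noetherian `R`-algebra and `M` is an `n`-quasi-generator of `mod-B`. -/
def RightPair.IsGamma (n : ℕ) (P : RightPair R) : Prop :=
  IsProjNoetherianAlg R P.B ∧ IsQuasiGenerator R P.B P.M n

/-- `DM ⊗_A M ∈ R-proj` and `Tor_i^A(DM, M) = 0` for all `i > 0`. -/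
def LeftPair.IsDualTorRigid (P : LeftPair R) : Prop :=
  FGProj R (BalTensor R P.A (StdDual R P.M) P.M) ∧
    ∀ i : ℕ, 0 < i → Limits.IsZero (TorMod R P.A (StdDual R P.M) i P.M)

/-- `A` is a projective Noetherian `R`-algebra and `M ∈ A-mod ∩ R-proj`. -/
def LeftPair.IsLattice (P : LeftPair R) : Prop :=
  IsProjNoetherianAlg R P.A ∧ Module.Finite P.A P.M ∧ FGProj R P.M

/-- `A` is a projective Noetherian `R`-algebra and `M ∈ A-mod ∩ R-proj` satisfies
`M-domdim (A, R) ≥ 2`, `pdim_A M = n`, `DM ⊗_A M ∈ R-proj` and `Tor_{i > 0}^A(DM, M) = 0`. -/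
def LeftPair.IsLambda (n : ℕ) (P : LeftPair R) : Prop :=
  P.IsLattice ∧ DomDimGE R P.A P.M P.A 2 ∧ PDimEq P.A P.M n ∧ P.IsDualTorRigid

/-- `M` is self-orthogonal: `Ext_A^i(M, M) = 0` for all `i > 0`. -/
def LeftPair.IsSelfOrthogonal (P : LeftPair R) : Prop :=
  ∀ i : ℕ, 0 < i → Subsingleton (Abelian.Ext (ModuleCat.of P.A P.M) (ModuleCat.of P.A P.M) i)

/-- Isomorphism of pairs: an isomorphism of `R`-algebras with a compatible additive isomorphism
of modules. -/
def RightPair.Iso (P P' : RightPair R) : Prop :=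
  ∃ (φ : P.B ≃ₐ[R] P'.B) (ψ : P.M ≃+ P'.M), ∀ (b : P.B) (m : P.M),
    ψ (op b • m) = op (φ b) • ψ m

/-- Isomorphism of pairs: an isomorphism of `R`-algebras with a compatible additive isomorphism
of modules. -/
def LeftPair.Iso (P P' : LeftPair R) : Prop :=
  ∃ (φ : P.A ≃ₐ[R] P'.A) (ψ : P.M ≃+ P'.M), ∀ (a : P.A) (m : P.M),
    ψ (a • m) = φ a • ψ m

theorem RightPair.iso_equivalence : Equivalence (RightPair.Iso (R := R)) where
  refl P := ⟨AlgEquiv.refl, AddEquiv.refl _, fun _ _ => rfl⟩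
  symm := by
    rintro P P' ⟨φ, ψ, h⟩
    refine ⟨φ.symm, ψ.symm, fun b m => ?_⟩
    rw [AddEquiv.symm_apply_eq, h, AlgEquiv.apply_symm_apply, AddEquiv.apply_symm_apply]
  trans := by
    rintro P P' P'' ⟨φ, ψ, h⟩ ⟨φ', ψ', h'⟩
    refine ⟨φ.trans φ', ψ.trans ψ', fun b m => ?_⟩
    simp only [AddEquiv.trans_apply, AlgEquiv.trans_apply, h, h']

theorem LeftPair.iso_equivalence : Equivalence (LeftPair.Iso (R := R)) where
  refl P := ⟨AlgEquiv.refl, AddEquiv.refl _, fun _ _ => rfl⟩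
  symm := by
    rintro P P' ⟨φ, ψ, h⟩
    refine ⟨φ.symm, ψ.symm, fun b m => ?_⟩
    rw [AddEquiv.symm_apply_eq, h, AlgEquiv.apply_symm_apply, AddEquiv.apply_symm_apply]
  trans := by
    rintro P P' P'' ⟨φ, ψ, h⟩ ⟨φ', ψ', h'⟩
    refine ⟨φ.trans φ', ψ.trans ψ', fun b m => ?_⟩
    simp only [AddEquiv.trans_apply, AlgEquiv.trans_apply, h, h']

/-- `(B, M) ↦ (End_B(M), M)`, where `End_B(M)` acts on `M` by evaluation. -/
def Phi (P : RightPair R) : LeftPair R where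
  A := Module.End P.Bᵐᵒᵖ P.M
  M := P.M

/-- A left module over `E` is a right module over `Eᵐᵒᵖ`, by `m * (op e) = e m`. -/
abbrev rightModuleOfLeft (E M : Type u) [Ring E] [AddCommGroup M] [Module E M] :
    Module Eᵐᵒᵖᵐᵒᵖ M :=
  Module.compHom M (RingEquiv.opOp E).symm.toRingHom

/-- `(A, M) ↦ (End_A(M)ᵒᵖ, M)`, where `End_A(M)ᵒᵖ` acts on `M` from the right by
`m * f = f m`. -/
def Psi (P : LeftPair R) : RightPair R :=
  letI : Module (Module.End P.A P.M)ᵐᵒᵖᵐᵒᵖ P.M := rightModuleOfLeft (Module.End P.A P.M) P.M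
  { B := (Module.End P.A P.M)ᵐᵒᵖ
    M := P.M
    tower := ⟨fun _ _ _ => rfl⟩ }

/-- The pairs of `Γ`, up to isomorphism. -/
def gammaSetoid (R : Type u) [CommRing R] (n : ℕ) :
    Setoid {P : RightPair R // P.IsGamma n} :=
  Setoid.comap Subtype.val ⟨RightPair.Iso, RightPair.iso_equivalence⟩

/-- The pairs of `Λ`, up to isomorphism. -/
def lambdaSetoid (R : Type u) [CommRing R] (n : ℕ) :
    Setoid {P : LeftPair R // P.IsLambda n} :=
  Setoid.comap Subtype.val ⟨LeftPair.Iso, LeftPair.iso_equivalence⟩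

/-- The class `Γ` of isomorphism classes of pairs `(B, M)` with `B` a projective Noetherian
`R`-algebra and `M` an `n`-quasi-generator of `mod-B`. -/
def Gamma (R : Type u) [CommRing R] (n : ℕ) : Type (u + 1) := Quotient (gammaSetoid R n)

/-- The class `Λ` of isomorphism classes of pairs `(A, M)` satisfying `LeftPair.IsLambda n`. -/
def Lambda (R : Type u) [CommRing R] (n : ℕ) : Type (u + 1) := Quotient (lambdaSetoid R n)

/-- The isomorphism class of a pair in `Γ`. -/
def Gamma.mk {n : ℕ} (P : RightPair R) (h : P.IsGamma n) : Gamma R n :=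
  Quotient.mk (gammaSetoid R n) ⟨P, h⟩

/-- The isomorphism class of a pair in `Λ`. -/
def Lambda.mk {n : ℕ} (P : LeftPair R) (h : P.IsLambda n) : Lambda R n :=
  Quotient.mk (lambdaSetoid R n) ⟨P, h⟩

end QuasiGen

/-!
Write a right `B`-module as a left module over `C = Bᵒᵖ`, so that on both sides of the
correspondence `M` carries commuting left actions of two `R`-algebras `A` and `C`, one of which is by
assumption the full endomorphism ring of `M` over the other.

*Double centralizer.* A module `Y` with `M`-dominant dimension at least two is reflexive: the
evaluation `Y → Hom_A(Hom_C(Y, M), M)` is bijective, because this holds for modules in `add M` and is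
inherited by kernels to which `Hom_C(-, M)` is applied exactly (`IsReflexive.kernel`,
`DomDimGE.isReflexive`). For `Y = C`, respectively with the roles of `A` and `C` exchanged, this says
that `A` and `C` are each other's centralizers on `M`. Hence `Φ` and `Ψ` are mutually inverse once
they are well defined.

*Duality.* There is a natural isomorphism `Hom_A(X, M) ≅ D(DM ⊗_A X)` (`homEquivDual`). Let
`0 → K → P → X → 0` be exact with `P` finitely generated projective. If `DM ⊗_A X` is projective over
`R` and `Tor₁(DM, X) = 0`, the sequence tensored with `DM` splits over `R`, so `DM ⊗_A K` is
projective and `Hom_A(-, M)` is exact on the sequence; conversely, exactness of `Hom_A(-, M)` and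
projectivity of `DM ⊗_A K` give back the two conditions on `X` (`FGProj.dualTensor_kernel`,
`FGProj.dualTensor_cokernel`). By dimension shifting, `Hom(-, M)` exchanges finite projective
resolutions of rigid reflexive `A`-modules with finite `add M`-coresolutions of `C`-modules
(`IsTorRigid.hasCores`, `HasCores.dual`). Applied to the pair `M`, `C` this matches the projective
dimension of `M` with the length of an `add M`-coresolution of `C`
(`IsTorRigid.hasProjectiveDimensionLE_iff`).

*Dominant dimension.* Applying `Hom_C(-, M)` to a presentation of `M` over `C` gives a copresentation
of `A` by modules in `add M`, and `DM ⊗_C M` is the cokernel of its `R`-dual. A map between finitely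
generated projective `R`-modules has projective cokernel iff it has a generalised inverse, a condition
stable under duality; so `A` has dominant dimension at least two iff `DM ⊗_C M` is projective
(`DomDimGE.fgProj_dualTensor`, `DomDimGE.of_fgProj_dualTensor`).

*Fields.* Over a field all splitting conditions are automatic and the duality identifies the vanishing
of `Tor_i^A(DM, X)` with that of `Ext^i_A(X, M)`, one dimension shift at a time.
-/

namespace QuasiGen

/-! ### Dimension shifting for left derived functors -/

section DimensionShift

open Limits

variable {C D : Type*} [Category* C] [Category* D] [Abelian C] [Abelian D]

/-- A short exact sequence `0 → K → P → X → 0` with `P` projective, spliced with a projective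
resolution `⋯ → Q₁ → Q₀ → K → 0`, gives a projective resolution of `X`. -/
noncomputable def spliceResolution {S : ShortComplex C} (hS : S.ShortExact)
    [Projective S.X₂] (Q : ChainComplex C ℕ) [∀ n, Projective (Q.X n)]
    (p : Q.X 0 ⟶ S.X₁) [Epi p] (w : Q.d 1 0 ≫ p = 0) (hp : (ShortComplex.mk _ _ w).Exact)
    (hQ : ∀ n, (ShortComplex.mk _ _ (Q.d_comp_d (n + 2) (n + 1) n)).Exact) :
    ProjectiveResolution S.X₃ where
  complex := Q.augment (p ≫ S.f) (by rw [← Category.assoc, w, zero_comp])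
  projective n := by
    cases n
    · exact inferInstanceAs (Projective S.X₂)
    · exact inferInstanceAs (Projective (Q.X _))
  π := (ChainComplex.toSingle₀Equiv _ _).symm ⟨S.g, by
    change (p ≫ S.f) ≫ S.g = 0
    rw [Category.assoc, S.zero, comp_zero]⟩
  quasiIso := ⟨fun n => by
    rcases n with _ | n
    · rw [ChainComplex.quasiIsoAt₀_iff, ShortComplex.quasiIso_iff_of_zeros']
      · have : Epi S.g := hS.epi_g
        let S' := ShortComplex.mk (p ≫ S.f) S.g (by rw [Category.assoc, S.zero, comp_zero])
        let φ : S' ⟶ S := { τ₁ := p, τ₂ := 𝟙 _, τ₃ := 𝟙 _ }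
        have : Epi φ.τ₁ := inferInstanceAs (Epi p)
        have : IsIso φ.τ₂ := inferInstanceAs (IsIso (𝟙 _))
        have : Mono φ.τ₃ := inferInstanceAs (Mono (𝟙 _))
        refine (ShortComplex.exact_and_epi_g_iff_of_iso (S₁ := S') ?_).1
          ⟨(ShortComplex.exact_iff_of_epi_of_isIso_of_mono φ).2 hS.exact, hS.epi_g⟩
        exact ShortComplex.isoMk (Iso.refl _) (Iso.refl _) (Iso.refl _)
            ((Category.id_comp _).trans (Category.comp_id _).symm)
            ((Category.id_comp _).trans ((ChainComplex.toSingle₀Equiv_symm_apply_f_zero _ _).trans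
              (Category.comp_id _).symm))
      all_goals rfl
    · rw [quasiIsoAt_iff_exactAt']
      · rcases n with _ | n
        · rw [HomologicalComplex.exactAt_iff' _ 2 1 0 (by simp) (by simp)]
          have : Mono S.f := hS.mono_f
          let S' := ShortComplex.mk (Q.d 1 0) (p ≫ S.f) (by rw [← Category.assoc, w, zero_comp])
          let φ : ShortComplex.mk _ _ w ⟶ S' := { τ₁ := 𝟙 _, τ₂ := 𝟙 _, τ₃ := S.f }
          have : Epi φ.τ₁ := inferInstanceAs (Epi (𝟙 _))
          have : IsIso φ.τ₂ := inferInstanceAs (IsIso (𝟙 _))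
          have : Mono φ.τ₃ := inferInstanceAs (Mono S.f)
          exact (ShortComplex.exact_iff_of_epi_of_isIso_of_mono φ).1 hp
        · rw [HomologicalComplex.exactAt_iff' _ (n + 1 + 1 + 1) (n + 1 + 1) (n + 1)
            (by simp) (by simp)]
          exact hQ n
      · apply ChainComplex.exactAt_succ_single_obj⟩

theorem isZero_leftDerived_iff_exact [EnoughProjectives C] (F : C ⥤ D) [F.Additive] {X : C}
    (P : ProjectiveResolution X) (n : ℕ) :
    IsZero ((F.leftDerived (n + 1)).obj X) ↔
      ((ShortComplex.mk _ _ (P.complex.d_comp_d (n + 2) (n + 1) n)).map F).Exact := by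
  rw [(P.isoLeftDerivedObj F (n + 1)).isZero_iff]
  erw [← HomologicalComplex.exactAt_iff_isZero_homology]
  rw [HomologicalComplex.exactAt_iff' _ (n + 2) (n + 1) n (by simp) (by simp)]
  rfl

/-- For `0 → K → P → X → 0` with `P` projective, `Lₙ₊₂F X` vanishes iff `Lₙ₊₁F K` does. -/
theorem isZero_leftDerived_shift [EnoughProjectives C] (F : C ⥤ D) [F.Additive]
    {S : ShortComplex C} (hS : S.ShortExact) [Projective S.X₂] (n : ℕ) :
    IsZero ((F.leftDerived (n + 2)).obj S.X₃) ↔ IsZero ((F.leftDerived (n + 1)).obj S.X₁) := by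
  let Q := ProjectiveResolution.of S.X₁
  have : Epi (show Q.complex.X 0 ⟶ S.X₁ from Q.π.f 0) := inferInstanceAs (Epi (Q.π.f 0))
  rw [isZero_leftDerived_iff_exact F (spliceResolution hS Q.complex (Q.π.f 0)
    Q.complex_d_comp_π_f_zero Q.exact₀ Q.exact_succ), isZero_leftDerived_iff_exact F Q]
  rfl

/-- For `0 → K → P → X → 0` with `P` projective and `F` right exact, `L₁F X` vanishes iff
`F K → F P` is a monomorphism. -/
theorem isZero_leftDerived_one [EnoughProjectives C] (F : C ⥤ D) [F.Additive]
    (hF : ∀ T : ShortComplex C, T.Exact → Epi T.g → (T.map F).Exact ∧ Epi (F.map T.g))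
    {S : ShortComplex C} (hS : S.ShortExact) [Projective S.X₂] :
    IsZero ((F.leftDerived 1).obj S.X₃) ↔ Mono (F.map S.f) := by
  let Q := ProjectiveResolution.of S.X₁
  obtain ⟨p, hpe, w, hp⟩ : ∃ (p : Q.complex.X 0 ⟶ S.X₁) (_ : Epi p) (w : Q.complex.d 1 0 ≫ p = 0),
    (ShortComplex.mk _ _ w).Exact :=
      ⟨Q.π.f 0, inferInstanceAs (Epi (Q.π.f 0)), Q.complex_d_comp_π_f_zero, Q.exact₀⟩
  rw [isZero_leftDerived_iff_exact F (spliceResolution hS Q.complex p w hp Q.exact_succ) 0]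
  obtain ⟨h1, h2⟩ := hF _ hp hpe
  have w' : F.map (Q.complex.d 1 0) ≫ F.map p = 0 := by rw [← F.map_comp, w, F.map_zero]
  change Epi (F.map p) at h2
  let S' := ShortComplex.mk (F.map (Q.complex.d 1 0)) (F.map p ≫ F.map S.f)
    (by rw [← Category.assoc, w', zero_comp])
  have key : S'.Exact ↔ Mono (F.map S.f) := by
    constructor
    · intro h'
      rw [Preadditive.mono_iff_cancel_zero]
      intro Y y hy
      obtain ⟨Z, π, hπ, q, hq⟩ := surjective_up_to_refinements_of_epi (F.map p) y
      obtain ⟨Z', π', hπ', q', hq'⟩ := h'.exact_up_to_refinements q (by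
        change q ≫ F.map p ≫ F.map S.f = 0
        rw [← Category.assoc, ← hq, Category.assoc, hy, comp_zero])
      have : π' ≫ π ≫ y = 0 := by
        rw [hq, ← Category.assoc, hq']
        change (q' ≫ F.map (Q.complex.d 1 0)) ≫ F.map p = 0
        rw [Category.assoc, w', comp_zero]
      rwa [← cancel_epi π, ← cancel_epi π', comp_zero, comp_zero]
    · intro h
      let φ : (ShortComplex.mk _ _ w).map F ⟶ S' :=
        { τ₁ := 𝟙 _
          τ₂ := 𝟙 _
          τ₃ := F.map S.f
          comm₁₂ := (Category.id_comp _).trans (Category.comp_id _).symm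
          comm₂₃ := Category.id_comp _ }
      have : Epi φ.τ₁ := inferInstanceAs (Epi (𝟙 _))
      have : IsIso φ.τ₂ := inferInstanceAs (IsIso (𝟙 _))
      have : Mono φ.τ₃ := h
      exact (ShortComplex.exact_iff_of_epi_of_isIso_of_mono φ).1 h1
  rw [← key]
  refine ShortComplex.exact_iff_of_iso ?_
  refine ShortComplex.isoMk (Iso.refl _) (Iso.refl _) (Iso.refl _) ?_ ?_
  · exact (Category.id_comp _).trans (Category.comp_id _).symm
  · exact (Category.id_comp _).trans ((F.map_comp p S.f).symm.trans (Category.comp_id _).symm)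

end DimensionShift

/-! ### Finitely generated projective modules and their duals -/

section Linear

variable {R : Type u} [CommRing R]
variable {U V W : Type u} [AddCommGroup U] [Module R U] [AddCommGroup V] [Module R V]
  [AddCommGroup W] [Module R W]

theorem FGProj.of_retract {S : Type u} [Ring S] [Module S U] [Module S V]
    (hV : FGProj S V) (i : U →ₗ[S] V) (p : V →ₗ[S] U)
    (h : p ∘ₗ i = LinearMap.id) : FGProj S U := by
  obtain ⟨_, _⟩ := hV
  exact ⟨Module.Finite.of_surjective p fun x => ⟨i x, LinearMap.congr_fun h x⟩,
    Module.Projective.of_split i p h⟩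

theorem FGProj.of_equiv {S : Type u} [Ring S] [Module S U] [Module S V]
    (hV : FGProj S V) (e : U ≃ₗ[S] V) : FGProj S U :=
  hV.of_retract e.toLinearMap e.symm.toLinearMap (by ext; simp)

theorem FGProj.pi {S : Type u} [Ring S] [Module S V] (hV : FGProj S V) (k : ℕ) :
    FGProj S (Fin k → V) := by
  obtain ⟨_, _⟩ := hV
  refine ⟨inferInstance, ?_⟩
  exact Module.Projective.of_equiv (DFinsupp.linearEquivFunOnFintype (R := S)
    (M := fun _ : Fin k => V))

theorem FGProj.dual (hV : FGProj R V) : FGProj R (V →ₗ[R] R) := by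
  obtain ⟨_, _⟩ := hV
  exact ⟨inferInstance, inferInstance⟩

/-- A linear map is regular if it has a generalised inverse `h` with `f h f = f`. Its kernel and
image are then direct summands. -/
def IsRegularMap (f : U →ₗ[R] V) : Prop := ∃ h : V →ₗ[R] U, ∀ x, f (h (f x)) = f x

theorem FGProj.of_isRegularMap {f : U →ₗ[R] V} {g : V →ₗ[R] W} (hV : FGProj R V)
    (hfg : Function.Exact f g) (hg : Function.Surjective g) (hf : IsRegularMap f) :
    FGProj R W := by
  obtain ⟨h, hh⟩ := hf
  have key : LinearMap.ker g ≤ LinearMap.ker (LinearMap.id - f ∘ₗ h) := by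
    intro x hx
    obtain ⟨y, rfl⟩ := (hfg x).1 hx
    simp [hh]
  let e : (V ⧸ LinearMap.ker g) ≃ₗ[R] W := g.quotKerEquivOfSurjective hg
  refine hV.of_retract ((LinearMap.ker g).liftQ _ key ∘ₗ e.symm.toLinearMap) g ?_
  ext w
  obtain ⟨v, rfl⟩ := hg w
  have : e.symm (g v) = Submodule.Quotient.mk v := by
    rw [LinearEquiv.symm_apply_eq]
    rfl
  simp [this, hfg.apply_apply_eq_zero]

/-- A map of modules whose cokernel and target are finitely generated projective is regular. -/
theorem isRegularMap_of_fgProj {f : U →ₗ[R] V} {g : V →ₗ[R] W} (hV : FGProj R V)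
    (hW : FGProj R W) (hfg : Function.Exact f g) (hg : Function.Surjective g) :
    IsRegularMap f := by
  obtain ⟨_, _⟩ := hV
  obtain ⟨_, _⟩ := hW
  obtain ⟨s, hs⟩ := Module.projective_lifting_property g LinearMap.id hg
  have hs' : ∀ w, g (s w) = w := LinearMap.congr_fun hs
  -- `1 - s g` projects `V` onto the image of `f`, which is therefore projective
  let q : V →ₗ[R] LinearMap.range f := (LinearMap.id - s ∘ₗ g).codRestrict _ fun v =>
    (hfg _).1 (by simp [hs'])
  obtain ⟨h, hh⟩ := Module.projective_lifting_property f.rangeRestrict q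
    f.surjective_rangeRestrict
  refine ⟨h, fun x => ?_⟩
  have := congrArg Subtype.val (LinearMap.congr_fun hh (f x))
  change f (h (f x)) = f x - s (g (f x)) at this
  simpa [hfg.apply_apply_eq_zero] using this

theorem IsRegularMap.dual {f : U →ₗ[R] V} (hf : IsRegularMap f) : IsRegularMap f.dualMap := by
  obtain ⟨h, hh⟩ := hf
  exact ⟨h.dualMap, fun φ => by ext; simp [hh]⟩

theorem IsRegularMap.conj {U' V' : Type u} [AddCommGroup U'] [Module R U'] [AddCommGroup V']
    [Module R V'] {f : U →ₗ[R] V} {f' : U' →ₗ[R] V'} (hf : IsRegularMap f) (e : U ≃ₗ[R] U')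
    (e' : V ≃ₗ[R] V') (h : ∀ x, f' (e x) = e' (f x)) : IsRegularMap f' := by
  obtain ⟨k, hk⟩ := hf
  refine ⟨e.toLinearMap ∘ₗ k ∘ₗ e'.symm.toLinearMap, fun x => ?_⟩
  obtain ⟨x, rfl⟩ := e.surjective x
  simp [h, hk]

theorem IsRegularMap.of_dual {f : U →ₗ[R] V} (hU : FGProj R U) (hV : FGProj R V)
    (hf : IsRegularMap f.dualMap) : IsRegularMap f := by
  obtain ⟨_, _⟩ := hU
  obtain ⟨_, _⟩ := hV
  exact hf.dual.conj (Module.evalEquiv R U).symm (Module.evalEquiv R V).symm fun x => by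
    rw [LinearEquiv.eq_symm_apply]
    ext φ
    change φ (f ((Module.evalEquiv R U).symm x)) = x (φ ∘ₗ f)
    exact Module.apply_evalEquiv_symm_apply R U (φ ∘ₗ f) x

/-- A map between finitely generated projective modules is split injective if its dual is
surjective. -/
theorem exists_retraction_of_dualMap_surjective {f : U →ₗ[R] V} (hU : FGProj R U)
    (hf : Function.Surjective f.dualMap) : ∃ r : V →ₗ[R] U, ∀ x, r (f x) = x := by
  obtain ⟨_, _⟩ := hU
  obtain ⟨s, hs⟩ := Module.projective_lifting_property f.dualMap LinearMap.id hf
  refine ⟨(Module.evalEquiv R U).symm.toLinearMap ∘ₗ s.dualMap ∘ₗ Module.Dual.eval R V,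
    fun x => ?_⟩
  simp only [LinearMap.comp_apply, LinearEquiv.coe_coe]
  rw [LinearEquiv.symm_apply_eq]
  ext φ
  simpa using LinearMap.congr_fun (LinearMap.congr_fun hs φ) x

end Linear

/-! ### Balanced tensor products -/

section Tensor

variable (R A : Type u) [CommRing R] [Ring A]
variable (N : Type u) [AddCommGroup N] [Module R N] [Module Aᵐᵒᵖ N]
variable {X Y Z : Type u} [AddCommGroup X] [Module A X] [AddCommGroup Y] [Module A Y]
  [AddCommGroup Z] [Module A Z]

/-- The universal property of `N ⊗_A X`. -/
noncomputable def BalTensor.lift {V : Type u} [AddCommGroup V] [Module R V]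
    (b : N →ₗ[R] X →ₗ[ℤ] V) (hb : ∀ n (a : A) x, b (op a • n) x = b n (a • x)) :
    BalTensor R A N X →ₗ[R] V :=
  Submodule.liftQ _ (TensorProduct.AlgebraTensorModule.lift b) (by
    refine Submodule.span_le.2 ?_
    rintro _ ⟨n, a, m, rfl⟩
    simp [hb])

theorem BalTensor.mk_smul_tmul (n : N) (a : A) (x : X) :
    (Submodule.Quotient.mk ((op a • n) ⊗ₜ[ℤ] x) : BalTensor R A N X) =
      Submodule.Quotient.mk (n ⊗ₜ[ℤ] (a • x)) :=
  (Submodule.Quotient.eq _).2 (Submodule.subset_span ⟨n, a, x, rfl⟩)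

/-- The map `n ↦ n ⊗ x`. -/
noncomputable def BalTensor.tmulRight (x : X) : N →ₗ[R] BalTensor R A N X where
  toFun n := Submodule.Quotient.mk (n ⊗ₜ[ℤ] x)
  map_add' m n := (congrArg Submodule.Quotient.mk (TensorProduct.add_tmul m n x)).trans
    (Submodule.Quotient.mk_add _)
  map_smul' _ _ := rfl

theorem BalTensor.mk_tmul_add (n : N) (x y : X) :
    BalTensor.tmulRight R A N (x + y) n =
      BalTensor.tmulRight R A N x n + BalTensor.tmulRight R A N y n :=
  (congrArg Submodule.Quotient.mk (TensorProduct.tmul_add n x y)).trans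
    (Submodule.Quotient.mk_add _)

theorem BalTensor.tmulRight_op_smul (n : N) (a : A) (x : X) :
    BalTensor.tmulRight R A N x (op a • n) = BalTensor.tmulRight R A N (a • x) n :=
  BalTensor.mk_smul_tmul R A N n a x

theorem BalTensor.map_comp (f : X →ₗ[A] Y) (g : Y →ₗ[A] Z) :
    BalTensor.map R A N (g ∘ₗ f) = BalTensor.map R A N g ∘ₗ BalTensor.map R A N f :=
  BalTensor.hom_ext R A N fun _ _ => rfl

theorem BalTensor.map_id :
    BalTensor.map R A N (LinearMap.id : X →ₗ[A] X) = LinearMap.id :=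
  BalTensor.hom_ext R A N fun _ _ => rfl

theorem BalTensor.map_surjective {g : Y →ₗ[A] Z} (hg : Function.Surjective g) :
    Function.Surjective (BalTensor.map R A N g) := by
  intro t
  obtain ⟨t, rfl⟩ := Submodule.Quotient.mk_surjective _ t
  induction t with
  | zero => exact ⟨0, by simp⟩
  | tmul n z =>
    obtain ⟨y, rfl⟩ := hg z
    exact ⟨Submodule.Quotient.mk (n ⊗ₜ y), rfl⟩
  | add s t hs ht =>
    obtain ⟨s', hs⟩ := hs
    obtain ⟨t', ht⟩ := ht
    exact ⟨s' + t', by rw [_root_.map_add, hs, ht, Submodule.Quotient.mk_add]⟩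

/-- `N ⊗_A -` is right exact. -/
theorem BalTensor.map_exact {f : X →ₗ[A] Y} {g : Y →ₗ[A] Z} (hfg : Function.Exact f g)
    (hg : Function.Surjective g) :
    Function.Exact (BalTensor.map R A N f) (BalTensor.map R A N g) := by
  have hex := lTensor_exact (R := ℤ) (f := f.restrictScalars ℤ) (g := g.restrictScalars ℤ) N
    hfg hg
  -- since `g` is surjective, every relation for `Z` lifts to a relation for `Y`
  have hle : balancedRel R A N Z ≤ (balancedRel R A N Y).map
      (TensorProduct.AlgebraTensorModule.map (LinearMap.id : N →ₗ[R] N)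
        (g.restrictScalars ℤ)) := by
    refine Submodule.span_le.2 ?_
    rintro _ ⟨n, a, z, rfl⟩
    obtain ⟨y, rfl⟩ := hg z
    exact ⟨_, Submodule.subset_span ⟨n, a, y, rfl⟩, by simp⟩
  intro t
  obtain ⟨t, rfl⟩ := Submodule.Quotient.mk_surjective _ t
  constructor
  · intro ht
    have ht' : (g.restrictScalars ℤ).lTensor N t ∈ balancedRel R A N Z :=
      (Submodule.Quotient.mk_eq_zero _).1 ht
    obtain ⟨s, hs, hs'⟩ := hle ht'
    obtain ⟨w, hw⟩ := (hex (t - s)).1 (by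
      rw [_root_.map_sub]
      exact sub_eq_zero.2 hs'.symm)
    refine ⟨Submodule.Quotient.mk w, ?_⟩
    change Submodule.Quotient.mk ((f.restrictScalars ℤ).lTensor N w) = _
    rw [hw, Submodule.Quotient.mk_sub, (Submodule.Quotient.mk_eq_zero _).2 hs, sub_zero]
  · rintro ⟨w, hw⟩
    rw [← hw, ← LinearMap.comp_apply, ← BalTensor.map_comp, hfg.linearMap_comp_eq_zero]
    exact LinearMap.congr_fun (BalTensor.hom_ext R A N (g := 0) fun n x =>
      congrArg Submodule.Quotient.mk (TensorProduct.tmul_zero _ n)) w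

/-- `M ⊗_B L` and `L ⊗_{Bᵒᵖ} M` are isomorphic over `R`, so that right `B`-modules may be treated as
left modules over `Bᵒᵖ`. -/
theorem FGProj.balTensor_swap {B : Type u} [Ring B] [Algebra R B] {M L : Type u} [AddCommGroup M]
    [Module R M] [Module Bᵐᵒᵖ M] [IsScalarTower R Bᵐᵒᵖ M] [AddCommGroup L] [Module R L]
    [Module B L] [Module Bᵐᵒᵖᵐᵒᵖ L] [IsScalarTower R Bᵐᵒᵖᵐᵒᵖ L]
    (hL : ∀ (b : B) (l : L), op (op b) • l = b • l) :
    FGProj R (BalTensor R B M L) ↔ FGProj R (BalTensor R Bᵐᵒᵖ L M) := by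
  have hLR : ∀ (r : R) (l : L), r • l = algebraMap R B r • l := fun r l => by
    rw [← hL, ← algebraMap_smul Bᵐᵒᵖᵐᵒᵖ r l]; rfl
  have hMR : ∀ (r : R) (m : M), r • m = op (algebraMap R B r) • m := fun r m => by
    rw [← algebraMap_smul Bᵐᵒᵖ r m]; rfl
  let f : BalTensor R B M L →ₗ[R] BalTensor R Bᵐᵒᵖ L M := BalTensor.lift R B M
    { toFun := fun m => ((BalTensor.tmulRight R Bᵐᵒᵖ L m).restrictScalars ℤ)
      map_add' := fun x y => LinearMap.ext fun l => BalTensor.mk_tmul_add R Bᵐᵒᵖ L l x y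
      map_smul' := fun r x => LinearMap.ext fun l => by
        change BalTensor.tmulRight R Bᵐᵒᵖ L (r • x) l = r • BalTensor.tmulRight R Bᵐᵒᵖ L x l
        rw [← _root_.map_smul, hLR, ← hL, BalTensor.tmulRight_op_smul, hMR] } (fun m b l => by
        change BalTensor.tmulRight R Bᵐᵒᵖ L (op b • m) l = BalTensor.tmulRight R Bᵐᵒᵖ L m (b • l)
        rw [← hL, BalTensor.tmulRight_op_smul])
  let g : BalTensor R Bᵐᵒᵖ L M →ₗ[R] BalTensor R B M L := BalTensor.lift R Bᵐᵒᵖ L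
    { toFun := fun l => ((BalTensor.tmulRight R B M l).restrictScalars ℤ)
      map_add' := fun x y => LinearMap.ext fun m => BalTensor.mk_tmul_add R B M m x y
      map_smul' := fun r x => LinearMap.ext fun m => by
        change BalTensor.tmulRight R B M (r • x) m = r • BalTensor.tmulRight R B M x m
        rw [← _root_.map_smul, hMR, BalTensor.tmulRight_op_smul, hLR] } (fun l b m => by
        change BalTensor.tmulRight R B M (op b • l) m = BalTensor.tmulRight R B M l (b • m)
        have := hL b.unop l
        rw [op_unop] at this
        rw [this, ← BalTensor.tmulRight_op_smul, op_unop])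
  have h1 : g ∘ₗ f = LinearMap.id := BalTensor.hom_ext _ _ _ fun _ _ => rfl
  have h2 : f ∘ₗ g = LinearMap.id := BalTensor.hom_ext _ _ _ fun _ _ => rfl
  exact ⟨fun h => h.of_retract _ _ h2, fun h => h.of_retract _ _ h1⟩

end Tensor

section Free

variable (R : Type u) {A : Type u} [CommRing R] [Ring A] [Algebra R A]
variable (N : Type u) [AddCommGroup N] [Module R N] [Module Aᵐᵒᵖ N] [IsScalarTower R Aᵐᵒᵖ N]
variable {P : Type u} [AddCommGroup P] [Module A P]

/-- `N ⊗_A A^k` is a direct summand of (in fact isomorphic to) `N^k`. -/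
theorem BalTensor.exists_retract_pi (k : ℕ) :
    ∃ (i : BalTensor R A N (Fin k → A) →ₗ[R] (Fin k → N))
      (p : (Fin k → N) →ₗ[R] BalTensor R A N (Fin k → A)), p ∘ₗ i = LinearMap.id := by
  have := IsScalarTower.to_smulCommClass (R := R) (A := Aᵐᵒᵖ) (M := N)
  refine ⟨BalTensor.lift (X := Fin k → A) R A N
    { toFun := fun n => AddMonoidHom.toIntLinearMap
        { toFun := fun (a : Fin k → A) i => op (a i) • n
          map_zero' := by ext; simp
          map_add' := fun a b => by ext; simp [add_smul] }
      map_add' := fun n n' => by ext; simp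
      map_smul' := fun r n => LinearMap.ext fun a => funext fun i =>
        (smul_comm r (op (a i)) n).symm } (fun n a b => by
          ext i
          exact smul_smul (op (b i)) (op a) n),
    ∑ i, BalTensor.tmulRight R A N (Pi.single i (1 : A)) ∘ₗ LinearMap.proj i, ?_⟩
  refine BalTensor.hom_ext R A N fun n a => ?_
  rw [LinearMap.comp_apply, LinearMap.sum_apply]
  change ∑ i, BalTensor.tmulRight R A N (Pi.single i (1 : A)) (op (a i) • n) = _
  simp_rw [BalTensor.tmulRight_op_smul]
  change ∑ i, Submodule.Quotient.mk (n ⊗ₜ[ℤ] (a i • Pi.single i (1 : A))) = _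
  refine (map_sum (Submodule.mkQ (balancedRel R A N (Fin k → A))) _ _).symm.trans ?_
  rw [← TensorProduct.tmul_sum]
  refine congrArg (fun b => Submodule.Quotient.mk (n ⊗ₜ[ℤ] b)) ?_
  ext j
  simp [Pi.single_apply, Finset.sum_apply]

theorem FGProj.balTensor (hN : FGProj R N) (hP : FGProj A P) : FGProj R (BalTensor R A N P) := by
  obtain ⟨_, _⟩ := hP
  obtain ⟨k, p, i, -, -, h⟩ := Module.Finite.exists_comp_eq_id_of_projective A P
  obtain ⟨i', p', h'⟩ := BalTensor.exists_retract_pi R N (A := A) k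
  refine ((hN.pi k).of_retract i' p' h').of_retract (BalTensor.map R A N i)
    (BalTensor.map R A N p) ?_
  rw [← BalTensor.map_comp, h, BalTensor.map_id]

theorem finite_balTensor (hN : FGProj R N) [Module.Finite A P] :
    Module.Finite R (BalTensor R A N P) := by
  obtain ⟨k, f, hf⟩ := Module.Finite.exists_fin' A P
  have : FGProj A A := ⟨inferInstance, inferInstance⟩
  have := (hN.balTensor R N (this.pi k)).1
  exact Module.Finite.of_surjective _ (BalTensor.map_surjective R A N hf)

end Free

/-! ### Dimension shifting for `Tor`, `Ext` and projective dimension of modules -/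

section Shift

variable {A : Type u} [Ring A]
variable {K P X : Type u} [AddCommGroup K] [Module A K] [AddCommGroup P] [Module A P]
  [AddCommGroup X] [Module A X]

/-- The short complex `K → P → X` in the category of `A`-modules. -/
abbrev shortCx {f : K →ₗ[A] P} {g : P →ₗ[A] X} (hfg : Function.Exact f g) :
    ShortComplex (ModuleCat.{u} A) :=
  ModuleCat.shortComplexOfCompEqZero f g hfg.linearMap_comp_eq_zero

theorem shortCx_shortExact {f : K →ₗ[A] P} {g : P →ₗ[A] X} (hfg : Function.Exact f g)
    (hf : Function.Injective f) (hg : Function.Surjective g) : (shortCx hfg).ShortExact :=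
  ModuleCat.shortComplex_shortExact _ hfg hf hg

section Tor

variable (R : Type u) [CommRing R] (N : Type u) [AddCommGroup N] [Module R N] [Module Aᵐᵒᵖ N]

theorem tensorFunctor_rightExact (T : ShortComplex (ModuleCat.{u} A)) (hT : T.Exact)
    (hg : Epi T.g) :
    (T.map (tensorFunctor R A N)).Exact ∧ Epi ((tensorFunctor R A N).map T.g) := by
  rw [ShortComplex.ShortExact.moduleCat_exact_iff_function_exact] at hT ⊢
  rw [ModuleCat.epi_iff_surjective] at hg ⊢
  exact ⟨BalTensor.map_exact R A N (f := T.f.hom) (g := T.g.hom) hT hg,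
    BalTensor.map_surjective R A N (g := T.g.hom) hg⟩

variable [Module.Projective A P]

theorem isZero_torMod_shift {f : K →ₗ[A] P} {g : P →ₗ[A] X} (hfg : Function.Exact f g)
    (hf : Function.Injective f) (hg : Function.Surjective g) (i : ℕ) :
    Limits.IsZero (TorMod R A N (i + 2) X) ↔ Limits.IsZero (TorMod R A N (i + 1) K) := by
  have : Projective (shortCx hfg).X₂ := (IsProjective.iff_projective P).1 inferInstance
  exact isZero_leftDerived_shift (tensorFunctor R A N) (shortCx_shortExact hfg hf hg) i

theorem isZero_torMod_one {f : K →ₗ[A] P} {g : P →ₗ[A] X} (hfg : Function.Exact f g)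
    (hf : Function.Injective f) (hg : Function.Surjective g) :
    Limits.IsZero (TorMod R A N 1 X) ↔ Function.Injective (BalTensor.map R A N f) := by
  have : Projective (shortCx hfg).X₂ := (IsProjective.iff_projective P).1 inferInstance
  rw [TorMod]
  have h := isZero_leftDerived_one (tensorFunctor R A N) (tensorFunctor_rightExact R N)
    (shortCx_shortExact hfg hf hg)
  rw [ModuleCat.mono_iff_injective] at h
  exact h

theorem isZero_torMod_of_projective (i : ℕ) : Limits.IsZero (TorMod R A N (i + 1) P) := by
  have : Projective (ModuleCat.of A P) := (IsProjective.iff_projective P).1 inferInstance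
  exact Functor.isZero_leftDerived_obj_projective_succ _ _ _

theorem isZero_torMod_of_equiv {Y : Type u} [AddCommGroup Y] [Module A Y] (e : X ≃ₗ[A] Y) (i : ℕ)
    (h : Limits.IsZero (TorMod R A N i X)) : Limits.IsZero (TorMod R A N i Y) :=
  h.of_iso (((tensorFunctor R A N).leftDerived i).mapIso e.toModuleIso.symm)

end Tor

section ExtShift

open Abelian

variable (L : Type u) [AddCommGroup L] [Module A L] [Module.Projective A P]

theorem subsingleton_ext_shift {f : K →ₗ[A] P} {g : P →ₗ[A] X} (hfg : Function.Exact f g)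
    (hf : Function.Injective f) (hg : Function.Surjective g) (i : ℕ) :
    Subsingleton (Ext (ModuleCat.of A X) (ModuleCat.of A L) (i + 2)) ↔
      Subsingleton (Ext (ModuleCat.of A K) (ModuleCat.of A L) (i + 1)) := by
  have : Projective (shortCx hfg).X₂ := (IsProjective.iff_projective P).1 inferInstance
  have hS := shortCx_shortExact hfg hf hg
  constructor
  · intro h
    refine subsingleton_of_forall_eq 0 fun x => ?_
    obtain ⟨y, hy⟩ := Ext.contravariant_sequence_exact₁ hS (ModuleCat.of A L) x
      (show 1 + (i + 1) = i + 2 by omega) (h.elim _ _)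
    rw [← hy, Ext.eq_zero_of_projective y, Ext.comp_zero]
  · intro h
    refine subsingleton_of_forall_eq 0 fun x => ?_
    obtain ⟨y, hy⟩ := Ext.contravariant_sequence_exact₃ hS (ModuleCat.of A L) x
      (Ext.eq_zero_of_projective _) (show 1 + (i + 1) = i + 2 by omega)
    rw [← hy, h.elim y 0, Ext.comp_zero]

theorem subsingleton_ext_one {f : K →ₗ[A] P} {g : P →ₗ[A] X} (hfg : Function.Exact f g)
    (hf : Function.Injective f) (hg : Function.Surjective g) :
    Subsingleton (Ext (ModuleCat.of A X) (ModuleCat.of A L) 1) ↔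
      Function.Surjective (fun h : P →ₗ[A] L => h ∘ₗ f) := by
  have : Projective (shortCx hfg).X₂ := (IsProjective.iff_projective P).1 inferInstance
  have hS := shortCx_shortExact hfg hf hg
  constructor
  · intro h φ
    obtain ⟨y, hy⟩ := Ext.contravariant_sequence_exact₁ hS (ModuleCat.of A L)
      (Ext.mk₀ (ModuleCat.ofHom φ)) (show 1 + 0 = 1 by omega) (h.elim _ _)
    obtain ⟨y, rfl⟩ := (Ext.mk₀_bijective _ _).2 y
    rw [Ext.mk₀_comp_mk₀] at hy
    exact ⟨y.hom, congrArg ModuleCat.Hom.hom ((Ext.mk₀_bijective _ _).1 hy)⟩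
  · intro h
    refine subsingleton_of_forall_eq 0 fun x => ?_
    obtain ⟨y, hy⟩ := Ext.contravariant_sequence_exact₃ hS (ModuleCat.of A L) x
      (Ext.eq_zero_of_projective _) (show 1 + 0 = 1 by omega)
    obtain ⟨y, rfl⟩ := (Ext.mk₀_bijective _ _).2 y
    obtain ⟨ψ, hψ⟩ := h y.hom
    have hy' : y = (shortCx hfg).f ≫ ModuleCat.ofHom ψ := by
      ext x
      exact (LinearMap.congr_fun hψ x).symm
    rw [← hy, hy', ← Ext.mk₀_comp_mk₀, hS.extClass_comp_assoc]

end ExtShift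

theorem hasProjectiveDimensionLE_succ_iff [Module.Projective A P] {f : K →ₗ[A] P} {g : P →ₗ[A] X}
    (hfg : Function.Exact f g) (hf : Function.Injective f) (hg : Function.Surjective g) (k : ℕ) :
    HasProjectiveDimensionLE (ModuleCat.of A X) (k + 1) ↔
      HasProjectiveDimensionLE (ModuleCat.of A K) k :=
  (shortCx_shortExact hfg hf hg).hasProjectiveDimensionLT_X₃_iff k
    ((IsProjective.iff_projective P).1 inferInstance)

theorem hasProjectiveDimensionLE_zero_iff :
    HasProjectiveDimensionLE (ModuleCat.of A X) 0 ↔ Module.Projective A X := by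
  rw [IsProjective.iff_projective X, projective_iff_hasProjectiveDimensionLE_zero]

theorem hasProjectiveDimensionLE_of_equiv {Y : Type u} [AddCommGroup Y] [Module A Y]
    (e : X ≃ₗ[A] Y) (k : ℕ) (h : HasProjectiveDimensionLE (ModuleCat.of A X) k) :
    HasProjectiveDimensionLE (ModuleCat.of A Y) k :=
  hasProjectiveDimensionLT_of_iso e.toModuleIso (k + 1)

end Shift

/-! ### The duality between `DM ⊗_A X` and `Hom_A(X, M)` -/

section Duality

variable {R A : Type u} [CommRing R] [Ring A] [Algebra R A]
variable {M : Type u} [AddCommGroup M] [Module R M] [Module A M] [IsScalarTower R A M]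

instance StdDual.isScalarTower : IsScalarTower R Aᵐᵒᵖ (StdDual R M) where
  smul_assoc r a f := StdDual.ext fun m => by
    change f ((r • a.unop) • m) = r • f (a.unop • m)
    rw [smul_assoc]
    exact LinearMap.map_smul f r _

variable (R A M) in
/-- `DM ⊗_A X`. -/
abbrev DualTensor (X : Type u) [AddCommGroup X] [Module A X] : Type u :=
  BalTensor R A (StdDual R M) X

variable (R A M) in
/-- The map `DM ⊗_A X → DM ⊗_A Y` induced by an `A`-linear map `X → Y`. -/
noncomputable abbrev DualTensor.map {X Y : Type u} [AddCommGroup X] [Module A X] [AddCommGroup Y]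
    [Module A Y] (f : X →ₗ[A] Y) : DualTensor R A M X →ₗ[R] DualTensor R A M Y :=
  BalTensor.map R A (StdDual R M) f

variable {X Y K P : Type u} [AddCommGroup X] [Module A X] [AddCommGroup Y] [Module A Y]
  [AddCommGroup K] [Module A K] [AddCommGroup P] [Module A P]

variable (R A M X) in
/-- The natural map `Hom_A(X, M) → D(DM ⊗_A X)`, sending `g` to `φ ⊗ x ↦ φ (g x)`. -/
noncomputable def homToDual : (X →ₗ[A] M) →ₗ[R] (DualTensor R A M X →ₗ[R] R) where
  toFun g := BalTensor.lift R A (StdDual R M)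
    { toFun := fun φ => AddMonoidHom.toIntLinearMap
        (AddMonoidHom.comp (LinearMap.toAddMonoidHom (show M →ₗ[R] R from φ)) g.toAddMonoidHom)
      map_add' := fun _ _ => rfl
      map_smul' := fun _ _ => rfl } (fun φ a x =>
        congrArg φ (g.map_smul a x).symm)
  map_add' g g' := BalTensor.hom_ext _ _ _ fun φ x => LinearMap.map_add φ (g x) (g' x)
  map_smul' r g := BalTensor.hom_ext _ _ _ fun φ x => LinearMap.map_smul φ r (g x)

theorem homToDual_comp (f : X →ₗ[A] Y) (g : Y →ₗ[A] M) :
    homToDual R A M X (g ∘ₗ f) = (DualTensor.map R A M f).dualMap (homToDual R A M Y g) :=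
  BalTensor.hom_ext _ _ _ fun _ _ => rfl

theorem homToDual_bijective (hM : FGProj R M) : Function.Bijective (homToDual R A M X) := by
  obtain ⟨_, _⟩ := hM
  have sep : ∀ m m' : M, (∀ φ : M →ₗ[R] R, φ m = φ m') → m = m' := fun m m' h =>
    (Module.evalEquiv R M).injective (LinearMap.ext h)
  constructor
  · intro g g' h
    ext x
    exact sep _ _ fun φ => LinearMap.congr_fun h
      (Submodule.Quotient.mk ((show StdDual R M from φ) ⊗ₜ[ℤ] x))
  · intro F
    let m : X → M := fun x => (Module.evalEquiv R M).symm
      (F ∘ₗ BalTensor.tmulRight R A (StdDual R M) x)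
    have hm : ∀ (φ : M →ₗ[R] R) x, φ (m x) =
        F (BalTensor.tmulRight R A (StdDual R M) x φ) := fun φ x =>
      Module.apply_evalEquiv_symm_apply R M φ _
    refine ⟨{ toFun := m, map_add' := fun x y => sep _ _ fun φ => ?_,
              map_smul' := fun a x => sep _ _ fun φ => ?_ }, ?_⟩
    · rw [map_add, hm, hm, hm]
      exact (congrArg F (BalTensor.mk_tmul_add R A (StdDual R M) φ x y)).trans (F.map_add _ _)
    · rw [hm, RingHom.id_apply]
      refine (congrArg F (BalTensor.tmulRight_op_smul R A (StdDual R M) φ a x)).symm.trans ?_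
      exact (hm (show M →ₗ[R] R from (op a • (show StdDual R M from φ))) x).symm
    · exact BalTensor.hom_ext _ _ _ fun φ x => hm φ x

/-- `Hom_A(X, M) ≅ D(DM ⊗_A X)`. -/
noncomputable def homEquivDual (hM : FGProj R M) :
    (X →ₗ[A] M) ≃ₗ[R] (DualTensor R A M X →ₗ[R] R) :=
  LinearEquiv.ofBijective (homToDual R A M X) (homToDual_bijective hM)

theorem FGProj.hom (hM : FGProj R M) (h : FGProj R (DualTensor R A M X)) :
    FGProj R (X →ₗ[A] M) :=
  h.dual.of_equiv (homEquivDual hM)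

theorem FGProj.stdDual (hM : FGProj R M) : FGProj R (StdDual R M) := hM.dual

theorem FGProj.dualTensor (hM : FGProj R M) (hP : FGProj A P) : FGProj R (DualTensor R A M P) :=
  hM.stdDual.balTensor R _ hP

theorem dualMap_surjective_iff (hM : FGProj R M) (f : K →ₗ[A] P) :
    Function.Surjective (DualTensor.map R A M f).dualMap ↔
      Function.Surjective (fun h : P →ₗ[A] M => h ∘ₗ f) := by
  constructor
  · intro h φ
    obtain ⟨t, ht⟩ := h (homToDual R A M K φ)
    obtain ⟨g, rfl⟩ := (homToDual_bijective hM).2 t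
    exact ⟨g, (homToDual_bijective hM).1 ((homToDual_comp f g).trans ht)⟩
  · intro h t
    obtain ⟨φ, rfl⟩ := (homToDual_bijective hM).2 t
    obtain ⟨g, rfl⟩ := h φ
    exact ⟨homToDual R A M P g, (homToDual_comp f g).symm⟩

/-- If `0 → K → P → X → 0` stays exact under `DM ⊗_A -` and `DM ⊗_A X` is projective over `R`,
then the tensored sequence splits, so that its dual `Hom_A(-, M)` is exact as well. -/
theorem FGProj.dualTensor_kernel (hM : FGProj R M) (hP : FGProj A P)
    {f : K →ₗ[A] P} {g : P →ₗ[A] X} (hfg : Function.Exact f g) (hg : Function.Surjective g)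
    (hX : FGProj R (DualTensor R A M X))
    (hf : Function.Injective (DualTensor.map R A M f)) :
    FGProj R (DualTensor R A M K) ∧ Function.Surjective (fun h : P →ₗ[A] M => h ∘ₗ f) := by
  have hTP := hM.dualTensor hP
  obtain ⟨h, hh⟩ := isRegularMap_of_fgProj hTP hX
    (BalTensor.map_exact R A (StdDual R M) hfg hg) (BalTensor.map_surjective R A _ hg)
  have hr : h ∘ₗ DualTensor.map R A M f = LinearMap.id :=
    LinearMap.ext fun x => hf (hh x)
  refine ⟨hTP.of_retract _ _ hr, (dualMap_surjective_iff hM f).1 fun t => ⟨t ∘ₗ h,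
    LinearMap.ext fun x => congrArg t (LinearMap.congr_fun hr x)⟩⟩

/-- Conversely, exactness of the dual sequence `Hom_A(-, M)` forces the sequence tensored with
`DM` to split. -/
theorem FGProj.dualTensor_cokernel (hM : FGProj R M) (hP : FGProj A P)
    {f : K →ₗ[A] P} {g : P →ₗ[A] X} (hfg : Function.Exact f g) (hg : Function.Surjective g)
    (hK : FGProj R (DualTensor R A M K))
    (hf : Function.Surjective (fun h : P →ₗ[A] M => h ∘ₗ f)) :
    FGProj R (DualTensor R A M X) ∧ Function.Injective (DualTensor.map R A M f) := by
  obtain ⟨r, hr⟩ := exists_retraction_of_dualMap_surjective hK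
    ((dualMap_surjective_iff hM f).2 hf)
  refine ⟨(hM.dualTensor hP).of_isRegularMap (BalTensor.map_exact R A (StdDual R M) hfg hg)
    (BalTensor.map_surjective R A _ hg) ⟨r, fun x => by rw [hr]⟩, ?_⟩
  exact Function.LeftInverse.injective (g := r) hr

end Duality

/-! ### Double centralizers and reflexive modules -/

section Reflexive

/-- Every `C`-endomorphism of `M` is the action of a unique element of `A`. -/
def IsCentralizer (A C M : Type u) [Ring A] [Ring C] [AddCommGroup M] [Module A M]
    [Module C M] : Prop :=
  ∀ f : M →ₗ[C] M, ∃! a : A, ∀ m, f m = a • m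

section HomMap

variable {A : Type*} {C M : Type u} [Ring A] [Ring C] [AddCommGroup M] [Module A M] [Module C M]
variable [SMulCommClass C A M]
variable {X Y Z : Type u} [AddCommGroup X] [Module C X] [AddCommGroup Y] [Module C Y]
  [AddCommGroup Z] [Module C Z]

variable (A M) in
/-- The `A`-linear map `Hom_C(Y, M) → Hom_C(X, M)` induced by a `C`-linear map `X → Y`. -/
def homMap (f : X →ₗ[C] Y) : (Y →ₗ[C] M) →ₗ[A] (X →ₗ[C] M) where
  toFun g := g ∘ₗ f
  map_add' _ _ := rfl
  map_smul' _ _ := rfl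

theorem homMap_apply (f : X →ₗ[C] Y) (g : Y →ₗ[C] M) : homMap A M f g = g ∘ₗ f := rfl

theorem homMap_exact {f : X →ₗ[C] Y} {g : Y →ₗ[C] Z} (hfg : Function.Exact f g)
    (hg : Function.Surjective g) : Function.Exact (homMap A M g) (homMap A M f) := by
  intro φ
  constructor
  · intro h
    have hle : LinearMap.ker g ≤ LinearMap.ker φ := fun y hy => by
      obtain ⟨x, rfl⟩ := (hfg y).1 hy
      exact LinearMap.congr_fun h x
    refine ⟨(LinearMap.ker g).liftQ φ hle ∘ₗ (g.quotKerEquivOfSurjective hg).symm.toLinearMap, ?_⟩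
    ext y
    have : (g.quotKerEquivOfSurjective hg).symm (g y) = Submodule.Quotient.mk y := by
      rw [LinearEquiv.symm_apply_eq]
      rfl
    simp [homMap_apply, this]
  · rintro ⟨ψ, rfl⟩
    ext x
    simp [homMap_apply, hfg.apply_apply_eq_zero]

theorem homMap_injective {g : Y →ₗ[C] Z} (hg : Function.Surjective g) :
    Function.Injective (homMap A M g) := fun φ ψ h => by
  ext z
  obtain ⟨y, rfl⟩ := hg z
  exact LinearMap.congr_fun h y

variable (A M) in
theorem exists_retract_homMap (i : X →ₗ[C] Y) (p : Y →ₗ[C] X) (h : p ∘ₗ i = LinearMap.id) :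
    homMap A M i ∘ₗ homMap A M p = LinearMap.id := by
  ext f x
  exact congrArg f (LinearMap.congr_fun h x)

variable (A M) in
/-- The functor `Hom_C(-, M)` on isomorphisms. -/
def homCongr (e : X ≃ₗ[C] Y) : (Y →ₗ[C] M) ≃ₗ[A] (X →ₗ[C] M) :=
  LinearEquiv.ofLinearMap (homMap A M e.toLinearMap) (homMap A M e.symm.toLinearMap)
    (exists_retract_homMap A M _ _ (by ext; simp)) (exists_retract_homMap A M _ _ (by ext; simp))

end HomMap

variable {A C M : Type u} [Ring A] [Ring C] [AddCommGroup M] [Module A M] [Module C M]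
variable [SMulCommClass C A M]
variable {X Y Z Q : Type u} [AddCommGroup X] [Module C X] [AddCommGroup Y] [Module C Y]
  [AddCommGroup Z] [Module C Z] [AddCommGroup Q] [Module C Q]

variable (A C M) in
/-- `X` is reflexive if the evaluation map `X → Hom_A(Hom_C(X, M), M)` is bijective; injectivity and
surjectivity are the two fields. -/
structure IsReflexive (X : Type u) [AddCommGroup X] [Module C X] : Prop where
  sep : ∀ x y : X, (∀ f : X →ₗ[C] M, f x = f y) → x = y
  eval : ∀ ψ : (X →ₗ[C] M) →ₗ[A] M, ∃ x : X, ∀ f, ψ f = f x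

theorem IsCentralizer.isReflexive (h : IsCentralizer A C M) : IsReflexive A C M M where
  sep _ _ h := h LinearMap.id
  eval ψ := ⟨ψ LinearMap.id, fun f => by
    obtain ⟨a, ha, -⟩ := h f
    have : f = a • LinearMap.id := LinearMap.ext ha
    rw [this, map_smul]
    rfl⟩

/-- The ring `C` is reflexive over itself as soon as it is the endomorphism ring of `M` over
`A`. -/
theorem IsCentralizer.isReflexive_self (h : IsCentralizer C A M) : IsReflexive A C M C where
  sep c c' hc := by
    obtain ⟨d, -, hd⟩ := h
      { toFun := fun m => c • m
        map_add' := smul_add c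
        map_smul' := fun a m => smul_comm c a m }
    exact (hd c fun m => rfl).trans (hd c' fun m => by
      have := hc (LinearMap.toSpanSingleton C M m)
      simpa using this).symm
  eval ψ := by
    obtain ⟨c, hc, -⟩ := h
      { toFun := fun m => ψ (LinearMap.toSpanSingleton C M m)
        map_add' := fun m m' => by rw [LinearMap.toSpanSingleton_add, map_add]
        map_smul' := fun a m => by
          rw [RingHom.id_apply, ← map_smul]
          congr 1
          ext
          simp }
    refine ⟨c, fun f => ?_⟩
    have := hc (f 1)
    simp only [LinearMap.coe_mk, AddHom.coe_mk] at this
    have hf : LinearMap.toSpanSingleton C M (f 1) = f := by ext; simp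
    rw [hf] at this
    rw [this, ← map_smul, smul_eq_mul, mul_one]

theorem IsReflexive.of_inAdd (hQ : IsReflexive A C M Q) (hX : InAdd C Q X) :
    IsReflexive A C M X := by
  obtain ⟨k, i, p, hip⟩ := hX
  have hip' : ∀ x, p (i x) = x := LinearMap.congr_fun hip
  refine ⟨fun x y h => ?_, fun ψ => ?_⟩
  · rw [← hip' x, ← hip' y]
    congr 1
    ext j
    exact hQ.sep _ _ fun f => h (f ∘ₗ LinearMap.proj j ∘ₗ i)
  · have hψ : ∀ j, ∃ q : Q, ∀ f : Q →ₗ[C] M, ψ (f ∘ₗ LinearMap.proj j ∘ₗ i) = f q := fun j =>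
      hQ.eval (ψ ∘ₗ homMap A M ((LinearMap.proj j : (Fin k → Q) →ₗ[C] Q) ∘ₗ i))
    choose q hq using hψ
    refine ⟨p q, fun f => ?_⟩
    -- decompose `f` along the coordinates of `Q^k`
    have hf : f = ∑ j, (f ∘ₗ p ∘ₗ LinearMap.single C (fun _ => Q) j) ∘ₗ LinearMap.proj j ∘ₗ i := by
      ext x
      conv_lhs => rw [← hip' x, ← Finset.univ_sum_single (i x)]
      simp [LinearMap.sum_apply]
    conv_lhs => rw [hf]
    rw [map_sum]
    simp_rw [hq]
    conv_rhs => rw [← Finset.univ_sum_single q]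
    simp

/-- The kernel of a map `X → Z` between reflexive modules is reflexive, provided all maps from
the kernel to `M` extend to `X`. -/
theorem IsReflexive.kernel {f : Y →ₗ[C] X} {g : X →ₗ[C] Z} (hX : IsReflexive A C M X)
    (hZ : IsReflexive A C M Z) (hf : Function.Injective f) (hfg : Function.Exact f g)
    (hs : Function.Surjective fun h : X →ₗ[C] M => h ∘ₗ f) : IsReflexive A C M Y := by
  refine ⟨fun x y h => hf (hX.sep _ _ fun φ => h (φ ∘ₗ f)), fun ψ => ?_⟩
  obtain ⟨x, hx⟩ := hX.eval (ψ ∘ₗ homMap A M f)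
  have hgx : g x = 0 := hZ.sep _ _ fun φ => by
    have h0 : (φ ∘ₗ g) ∘ₗ f = 0 := by
      ext y
      simp [hfg.apply_apply_eq_zero]
    have := hx (φ ∘ₗ g)
    rw [LinearMap.comp_apply, homMap_apply, h0, map_zero] at this
    rw [map_zero]
    exact this.symm
  obtain ⟨y, rfl⟩ := (hfg x).1 hgx
  refine ⟨y, fun φ => ?_⟩
  obtain ⟨φ', rfl⟩ := hs φ
  exact hx φ'

/-- The evaluation isomorphism `X ≅ Hom_A(Hom_C(X, M), M)` of a reflexive module. -/
noncomputable def IsReflexive.equiv [SMulCommClass A C M] (h : IsReflexive A C M X) :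
    X ≃ₗ[C] ((X →ₗ[C] M) →ₗ[A] M) :=
  LinearEquiv.ofBijective
    { toFun := fun x =>
        { toFun := fun f => f x
          map_add' := fun _ _ => rfl
          map_smul' := fun _ _ => rfl }
      map_add' := fun x y => LinearMap.ext fun f => f.map_add x y
      map_smul' := fun c x => LinearMap.ext fun f => f.map_smul c x }
    ⟨fun x y hxy => h.sep x y fun f => LinearMap.congr_fun hxy f, fun ψ => by
      obtain ⟨x, hx⟩ := h.eval ψ
      exact ⟨x, (LinearMap.ext hx).symm⟩⟩

theorem IsReflexive.of_equiv (hX : IsReflexive A C M X) (e : X ≃ₗ[C] Y) :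
    IsReflexive A C M Y := by
  refine ⟨fun x y h => ?_, fun ψ => ?_⟩
  · exact e.symm.injective (hX.sep _ _ fun f => by
      simpa using h (f ∘ₗ e.symm.toLinearMap))
  · obtain ⟨x, hx⟩ := hX.eval (ψ ∘ₗ homMap A M e.symm.toLinearMap)
    refine ⟨e x, fun f => ?_⟩
    have := hx (f ∘ₗ e.toLinearMap)
    simp only [LinearMap.comp_apply, homMap_apply, LinearEquiv.coe_coe] at this
    rw [← this]
    congr 1
    ext y
    simp

theorem IsReflexive.isCentralizer (h : IsReflexive A C M C) : IsCentralizer C A M := by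
  intro φ
  obtain ⟨c, hc⟩ := h.eval (φ ∘ₗ (LinearMap.ringLmapEquivSelf C A M).toLinearMap)
  refine ⟨c, fun m => ?_, fun d hd => ?_⟩
  · simpa using hc (LinearMap.toSpanSingleton C M m)
  · refine h.sep _ _ fun f => ?_
    have h1 := hc f
    have h2 := hd (f 1)
    simp only [LinearMap.comp_apply, LinearEquiv.coe_coe, LinearMap.ringLmapEquivSelf_apply] at h1
    rw [← h1, h2, ← map_smul, smul_eq_mul, mul_one]

/-- If `A` is the endomorphism ring of `M` over `C`, then `A ≅ Hom_C(M, M)` as left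
`A`-modules. -/
noncomputable def IsCentralizer.equiv (h : IsCentralizer A C M) : A ≃ₗ[A] (M →ₗ[C] M) :=
  LinearEquiv.ofBijective (LinearMap.toSpanSingleton A (M →ₗ[C] M) LinearMap.id)
    ⟨fun a b hab => (h (b • LinearMap.id)).unique
      (fun m => by simpa using (LinearMap.congr_fun hab m).symm) (fun m => rfl), fun φ => by
        obtain ⟨a, ha, -⟩ := h φ
        exact ⟨a, by ext m; simp [ha]⟩⟩

theorem fgProj_hom_of_inAdd (h : IsCentralizer A C M) (hX : InAdd C M X) :
    FGProj A (X →ₗ[C] M) := by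
  obtain ⟨k, i, p, hip⟩ := hX
  have hA : FGProj A A := ⟨inferInstance, inferInstance⟩
  have h1 : FGProj A (M →ₗ[C] M) := hA.of_equiv h.equiv.symm
  exact ((h1.pi k).of_equiv (LinearMap.lsum C (fun _ : Fin k => M) A).symm).of_retract
    (homMap A M p) (homMap A M i) (exists_retract_homMap A M i p hip)

theorem inAdd_hom_of_fgProj (hX : FGProj C X) : InAdd A M (X →ₗ[C] M) := by
  obtain ⟨_, _⟩ := hX
  obtain ⟨k, p, i, -, -, h⟩ := Module.Finite.exists_comp_eq_id_of_projective C X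
  let e : (Fin k → M) ≃ₗ[A] ((Fin k → C) →ₗ[C] M) :=
    (LinearEquiv.piCongrRight fun _ : Fin k => (LinearMap.ringLmapEquivSelf C A M).symm).trans
      (LinearMap.lsum C (fun _ : Fin k => C) A)
  refine ⟨k, e.symm.toLinearMap ∘ₗ homMap A M p, homMap A M i ∘ₗ e.toLinearMap, ?_⟩
  ext f x
  simpa [homMap_apply] using congrArg f (LinearMap.congr_fun h x)

theorem inAdd_of_equiv (hX : InAdd C Q X) (e : X ≃ₗ[C] Y) : InAdd C Q Y := by
  obtain ⟨k, i, p, hip⟩ := hX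
  refine ⟨k, i ∘ₗ e.symm.toLinearMap, e.toLinearMap ∘ₗ p, ?_⟩
  ext y
  simpa [LinearEquiv.eq_symm_apply] using congrArg e (LinearMap.congr_fun hip (e.symm y))

end Reflexive

/-- A module in `add M` is finitely generated projective over `R` when `M` is. -/
theorem FGProj.of_inAdd {R C M X : Type u} [CommRing R] [Ring C] [Algebra R C] [AddCommGroup M]
    [Module R M] [Module C M] [IsScalarTower R C M] [AddCommGroup X] [Module R X] [Module C X]
    [IsScalarTower R C X] (hM : FGProj R M) (hX : InAdd C M X) : FGProj R X := by
  obtain ⟨k, i, p, hip⟩ := hX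
  refine (hM.pi k).of_retract (i.restrictScalars R) (p.restrictScalars R) ?_
  ext x
  exact LinearMap.congr_fun hip x

/-! ### Finite coresolutions by `add M` -/

section Cores

variable (R C : Type u) [CommRing R] [Ring C] [Algebra R C]
variable (M : Type u) [AddCommGroup M] [Module C M]

/-- Recursive form of `HasAddCores`: there is an exact sequence `0 → Y → M₀ → ⋯ → M_k → 0` with
all `Mᵢ ∈ add M` which remains exact under `Hom_C(-, M)`. The `R`-splitting is not recorded: it is
automatic when `M` is projective over `R`. -/
def HasCores : ℕ → ∀ (Y : Type u) [AddCommGroup Y] [Module R Y] [Module C Y]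
    [IsScalarTower R C Y], Prop
  | 0, Y, _, _, _, _ => InAdd C M Y
  | k + 1, Y, _, _, _, _ => ∃ (Q Z : Type u) (_ : AddCommGroup Q) (_ : Module R Q)
      (_ : Module C Q) (_ : IsScalarTower R C Q) (_ : AddCommGroup Z) (_ : Module R Z)
      (_ : Module C Z) (_ : IsScalarTower R C Z) (f : Y →ₗ[C] Q) (g : Q →ₗ[C] Z),
      InAdd C M Q ∧ Function.Injective f ∧ Function.Exact f g ∧ Function.Surjective g ∧
        Function.Surjective (fun h : Q →ₗ[C] M => h ∘ₗ f) ∧ HasCores k Z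

variable {R C M}
variable {X Y Z Q : Type u} [AddCommGroup X] [Module R X] [Module C X] [IsScalarTower R C X]
  [AddCommGroup Y] [Module R Y] [Module C Y] [IsScalarTower R C Y]
  [AddCommGroup Z] [Module R Z] [Module C Z] [IsScalarTower R C Z]
  [AddCommGroup Q] [Module R Q] [Module C Q] [IsScalarTower R C Q]

theorem HasCores.of_equiv {k : ℕ} (h : HasCores R C M k X) (e : X ≃ₗ[C] Y) :
    HasCores R C M k Y := by
  cases k with
  | zero => exact inAdd_of_equiv h e
  | succ k =>
    obtain ⟨Q, Z, _, _, _, _, _, _, _, _, f, g, hQ, hf, hfg, hg, hs, hZ⟩ := h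
    refine ⟨Q, Z, _, _, _, inferInstance, _, _, _, inferInstance, f ∘ₗ e.symm.toLinearMap, g, hQ,
      hf.comp e.symm.injective, fun q => (hfg q).trans ?_, hg, fun φ => ?_, hZ⟩
    · constructor
      · rintro ⟨x, rfl⟩
        exact ⟨e x, by simp⟩
      · rintro ⟨y, rfl⟩
        exact ⟨e.symm y, rfl⟩
    · obtain ⟨ψ, hψ⟩ := hs (φ ∘ₗ e.toLinearMap)
      refine ⟨ψ, ?_⟩
      ext y
      simpa using LinearMap.congr_fun hψ (e.symm y)

theorem HasCores.fgProj [Module R M] [IsScalarTower R C M] (hM : FGProj R M) {k : ℕ}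
    (h : HasCores R C M k Y) : FGProj R Y := by
  induction k generalizing Y with
  | zero => exact FGProj.of_inAdd (C := C) hM h
  | succ k ih =>
    obtain ⟨Q, Z, _, _, _, _, _, _, _, _, f, g, hQ, hf, hfg, hg, hs, hZ⟩ := h
    have hQR : FGProj R Q := FGProj.of_inAdd (C := C) hM hQ
    obtain ⟨h, hh⟩ := isRegularMap_of_fgProj (f := f.restrictScalars R)
      (g := g.restrictScalars R) hQR (ih hZ) hfg hg
    exact hQR.of_retract (f.restrictScalars R) h (LinearMap.ext fun x => hf (hh x))

/-- The sequence `0 → X → Y → Z → 0 → 0 → ⋯`. -/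
def ModSeq.ofTwo (f : X →ₗ[C] Y) (g : Y →ₗ[C] Z) : ModSeq R C where
  X
    | 0 => X
    | 1 => Y
    | 2 => Z
    | _ + 3 => PUnit
  grp
    | 0 => ‹AddCommGroup X›
    | 1 => ‹AddCommGroup Y›
    | 2 => ‹AddCommGroup Z›
    | _ + 3 => inferInstanceAs (AddCommGroup PUnit.{u + 1})
  modR
    | 0 => ‹Module R X›
    | 1 => ‹Module R Y›
    | 2 => ‹Module R Z›
    | _ + 3 => (inferInstance : Module R PUnit.{u + 1})
  modA
    | 0 => ‹Module C X›
    | 1 => ‹Module C Y›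
    | 2 => ‹Module C Z›
    | _ + 3 => (inferInstance : Module C PUnit.{u + 1})
  tower
    | 0 => ‹IsScalarTower R C X›
    | 1 => ‹IsScalarTower R C Y›
    | 2 => ‹IsScalarTower R C Z›
    | _ + 3 => (inferInstance : IsScalarTower R C PUnit.{u + 1})
  d
    | 0 => f
    | 1 => g
    | 2 => (0 : Z →ₗ[C] PUnit.{u + 1})
    | _ + 3 => (0 : PUnit.{u + 1} →ₗ[C] PUnit.{u + 1})

theorem ModSeq.ofTwo_isAddCopres {f : X →ₗ[C] Y} {g : Y →ₗ[C] Z} (hY : InAdd C M Y)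
    (hZ : InAdd C M Z) (hfg : Function.Exact f g) (r : Y →ₗ[R] X) (s : Z →ₗ[R] Y)
    (hr : ∀ x, r (f x) = x) (hs : ∀ y, f (r y) + s (g y) = y)
    (he : Function.Surjective fun h : Y →ₗ[C] M => h ∘ₗ f)
    (he' : Function.Exact (fun h : Z →ₗ[C] M => h ∘ₗ g) (fun h : Y →ₗ[C] M => h ∘ₗ f)) :
    (ModSeq.ofTwo (R := R) f g).IsAddCopres M X 2 := by
  refine ⟨⟨LinearEquiv.refl C X⟩, ?_, ⟨fun _ => ?_, ?_⟩, ⟨fun i => ?_, fun _ => ?_, ?_⟩,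
    fun _ => ?_, ?_⟩
  · intro i hi
    match i, hi with
    | 0, _ => exact hY
    | 1, _ => exact hZ
  · exact Function.LeftInverse.injective (g := r) hr
  · intro i hi
    match i, hi with
    | 0, _ => exact hfg
  · match i with
    | 0 => exact r
    | 1 => exact s
    | _ + 2 => exact 0
  · exact hr
  · intro i hi
    match i, hi with
    | 0, _ => exact hs
  · exact he
  · intro i hi
    match i, hi with
    | 0, _ => exact he'

/-- The sequence `0 → Y → Q → S₁ → S₂ → ⋯` obtained from a map `Q → S₀`. -/
def ModSeq.splice (S : ModSeq R C) (f : Y →ₗ[C] Q) (g : Q →ₗ[C] S.X 0) : ModSeq R C where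
  X
    | 0 => Y
    | 1 => Q
    | i + 2 => S.X (i + 1)
  grp
    | 0 => ‹AddCommGroup Y›
    | 1 => ‹AddCommGroup Q›
    | i + 2 => S.grp (i + 1)
  modR
    | 0 => ‹Module R Y›
    | 1 => ‹Module R Q›
    | i + 2 => S.modR (i + 1)
  modA
    | 0 => ‹Module C Y›
    | 1 => ‹Module C Q›
    | i + 2 => S.modA (i + 1)
  tower
    | 0 => ‹IsScalarTower R C Y›
    | 1 => ‹IsScalarTower R C Q›
    | i + 2 => S.tower (i + 1)
  d
    | 0 => f
    | 1 => S.d 0 ∘ₗ g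
    | i + 2 => S.d (i + 1)

theorem ModSeq.splice_isAddCopres {S : ModSeq R C} {W : Type u} [AddCommGroup W] [Module C W]
    {n : ℕ} (hS : S.IsAddCopres M W (n + 1))
    {f : Y →ₗ[C] Q} {g : Q →ₗ[C] S.X 0} (hQ : InAdd C M Q) (hf : Function.Injective f)
    (hfg : Function.Exact f g) (hg : Function.Surjective g)
    (he : Function.Surjective fun h : Q →ₗ[C] M => h ∘ₗ f)
    (r : Q →ₗ[R] Y) (s : S.X 0 →ₗ[R] Q) (hr : ∀ y, r (f y) = y) (hs : ∀ x, g (s x) = x)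
    (hrs : ∀ q, f (r q) + s (g q) = q) :
    (S.splice f g).IsAddCopres M Y (n + 2) := by
  obtain ⟨-, hadd, ⟨hinj, hex⟩, ⟨h, hh0, hh⟩, hsurj, hhom⟩ := hS
  have hinj := hinj n.succ_pos
  have hh0 := hh0 n.succ_pos
  have hsurj := hsurj n.succ_pos
  refine ⟨⟨LinearEquiv.refl C Y⟩, ?_, ⟨fun _ => hf, ?_⟩, ⟨fun i => ?_, fun _ => ?_, ?_⟩,
    fun _ => he, ?_⟩
  · intro i hi
    match i, hi with
    | 0, _ => exact hQ
    | i + 1, hi => exact hadd i (by omega)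
  · intro i hi
    match i, hi with
    | 0, _ =>
      exact fun q => Iff.trans ⟨fun hq => hinj (hq.trans (map_zero (S.d 0)).symm),
        fun hq => (congrArg (S.d 0) hq).trans (map_zero (S.d 0))⟩ (hfg q)
    | 1, hi =>
      refine fun x => (hex 0 (by omega) x).trans ⟨?_, ?_⟩
      · rintro ⟨y, rfl⟩
        obtain ⟨q, rfl⟩ := hg y
        exact ⟨q, rfl⟩
      · rintro ⟨q, rfl⟩
        exact ⟨g q, rfl⟩
    | i + 2, hi => exact hex (i + 1) (by omega)
  · match i with
    | 0 => exact r
    | 1 => exact s ∘ₗ h 0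
    | i + 2 => exact h (i + 1)
  · exact hr
  · intro i hi
    match i, hi with
    | 0, _ =>
      intro q
      exact (congrArg (fun x => f (r q) + s x) (hh0 (g q))).trans (hrs q)
    | 1, hi =>
      intro x
      exact (congrArg (fun y => S.d 0 y + h 1 (S.d 1 x)) (hs (h 0 x))).trans
        (hh 0 (by omega) x)
    | i + 2, hi => exact hh (i + 1) (by omega)
  · intro i hi
    match i, hi with
    | 0, _ =>
      have hex' : Function.Exact (fun φ : S.X 0 →ₗ[C] M => φ ∘ₗ g)
          (fun φ : Q →ₗ[C] M => φ ∘ₗ f) := homMap_exact (A := ℤ) hfg hg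
      refine fun φ => (hex' φ).trans ⟨?_, ?_⟩
      · rintro ⟨ψ, rfl⟩
        obtain ⟨χ, rfl⟩ := hsurj ψ
        exact ⟨χ, rfl⟩
      · rintro ⟨χ, rfl⟩
        exact ⟨χ ∘ₗ S.d 0, rfl⟩
    | 1, hi =>
      refine fun φ => Iff.trans ⟨fun h0 => ?_, fun h0 => ?_⟩ (hhom 0 (by omega) φ)
      · ext x
        obtain ⟨q, rfl⟩ := hg x
        exact LinearMap.congr_fun h0 q
      · exact congrArg (fun ψ : S.X 0 →ₗ[C] M => ψ ∘ₗ g) h0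
    | i + 2, hi => exact hhom (i + 1) (by omega)

/-- Truncating a finite coresolution after two steps. -/
theorem HasAddCores.domDimGE {W : Type u} [AddCommGroup W] [Module C W] {k : ℕ}
    (h : HasAddCores R C M W k) : DomDimGE R C M W 2 := by
  obtain ⟨S, ⟨e, hadd, ⟨hinj, hex⟩, ⟨h, hh0, hh⟩, hsurj, hhom⟩, -⟩ := h
  exact ⟨S, e, fun i hi => hadd i (by omega),
    ⟨fun _ => hinj (by omega), fun i hi => hex i (by omega)⟩,
    ⟨h, fun _ => hh0 (by omega), fun i hi => hh i (by omega)⟩,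
    fun _ => hsurj (by omega), fun i hi => hhom i (by omega)⟩

theorem HasAddCores.hasCores {k : ℕ} (h : HasAddCores R C M Y k) : HasCores R C M k Y := by
  obtain ⟨S, ⟨⟨e⟩, hadd, ⟨hinj, hex⟩, -, hsurj, hhom⟩, hsub⟩ := h
  have hinj := hinj (Nat.succ_pos _)
  have hsurj := hsurj (Nat.succ_pos _)
  -- maps from the image of `d j` to `M` extend to `X (j + 1)`
  have hext : ∀ j, j ≤ k → Function.Surjective
      fun h : S.X (j + 1) →ₗ[C] M => h ∘ₗ (LinearMap.range (S.d j)).subtype := by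
    intro j hj φ
    obtain ⟨ψ, hψ⟩ : ∃ ψ : S.X (j + 1) →ₗ[C] M, ψ ∘ₗ S.d j = φ ∘ₗ (S.d j).rangeRestrict := by
      cases j with
      | zero => exact hsurj _
      | succ j =>
        refine (hhom j (by omega) _).1 (LinearMap.ext fun x => ?_)
        have : (S.d (j + 1)).rangeRestrict (S.d j x) = 0 :=
          Subtype.ext ((hex j (by omega)).apply_apply_eq_zero x)
        simp [this]
    refine ⟨ψ, ?_⟩
    ext ⟨_, x, rfl⟩
    exact LinearMap.congr_fun hψ x
  have key : ∀ m j, j + m = k → HasCores R C M m (LinearMap.range (S.d j)) := by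
    intro m
    induction m with
    | zero =>
      intro j hj
      obtain rfl : j = k := hj
      refine inAdd_of_equiv (hadd j (by omega)) (LinearEquiv.ofTop _ ?_).symm
      rw [eq_top_iff]
      exact fun x _ => (hex j (by omega) x).1 (Subsingleton.elim _ _)
    | succ m ih =>
      intro j hj
      refine ⟨S.X (j + 1), LinearMap.range (S.d (j + 1)), _, _, _, inferInstance, _, _, _,
        inferInstance, (LinearMap.range (S.d j)).subtype, (S.d (j + 1)).rangeRestrict,
        hadd j (by omega), Subtype.val_injective, fun x => ?_, LinearMap.surjective_rangeRestrict _,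
        hext j (by omega), ih (j + 1) (by omega)⟩
      have h1 : (S.d (j + 1)).rangeRestrict x = 0 ↔ S.d (j + 1) x = 0 := Subtype.ext_iff
      rw [h1, hex j (by omega) x]
      exact ⟨fun ⟨y, hy⟩ => ⟨⟨x, y, hy⟩, rfl⟩, fun ⟨⟨_, y, hy⟩, hx⟩ => ⟨y, hy.trans hx⟩⟩
  exact (key k 0 (by omega)).of_equiv ((LinearEquiv.ofInjective (S.d 0) hinj).symm.trans e.symm)

theorem inAdd_pUnit : InAdd C M PUnit.{u + 1} := ⟨0, 0, 0, Subsingleton.elim _ _⟩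

theorem HasCores.hasAddCores [Module R M] [IsScalarTower R C M] (hM : FGProj R M) {k : ℕ}
    (h : HasCores R C M k Y) : HasAddCores R C M Y k := by
  induction k generalizing Y with
  | zero =>
    refine ⟨ModSeq.ofTwo (R := R) (LinearMap.id : Y →ₗ[C] Y) (0 : Y →ₗ[C] PUnit.{u + 1}),
      ModSeq.ofTwo_isAddCopres h inAdd_pUnit (fun y => ?_) LinearMap.id 0 (fun _ => rfl)
        (fun y => by simp) (fun φ => ⟨φ, rfl⟩) (fun φ => ?_), inferInstanceAs (Subsingleton PUnit)⟩
    · exact ⟨fun _ => ⟨y, rfl⟩, fun _ => rfl⟩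
    · constructor
      · intro hφ
        exact ⟨0, by simpa using hφ.symm⟩
      · rintro ⟨ψ, rfl⟩
        simp
  | succ k ih =>
    obtain ⟨Q, Z, _, _, _, _, _, _, _, _, f, g, hQ, hf, hfg, hg, hs, hZ⟩ := h
    obtain ⟨S, hS, hsub⟩ := ih hZ
    obtain ⟨e⟩ := hS.1
    obtain ⟨_, _⟩ := hZ.fgProj hM
    obtain ⟨s, hgs⟩ := Module.projective_lifting_property (g.restrictScalars R) LinearMap.id hg
    have hgs' : ∀ z, g (s z) = z := LinearMap.congr_fun hgs
    have hker : ∀ q, q - s (g q) ∈ LinearMap.range (f.restrictScalars R) := fun q =>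
      (hfg _).1 (by simp [hgs'])
    let r : Q →ₗ[R] Y := (LinearEquiv.ofInjective (f.restrictScalars R) hf).symm.toLinearMap ∘ₗ
      (LinearMap.id - s ∘ₗ g.restrictScalars R).codRestrict _ hker
    have hfr : ∀ q, f (r q) = q - s (g q) := fun q =>
      congrArg Subtype.val ((LinearEquiv.ofInjective (f.restrictScalars R) hf).apply_symm_apply
        ⟨q - s (g q), hker q⟩)
    have hrf : ∀ y, r (f y) = y := fun y => hf (by
      rw [hfr, hfg.apply_apply_eq_zero, map_zero, sub_zero])
    refine ⟨S.splice f (e.toLinearMap ∘ₗ g), ModSeq.splice_isAddCopres hS hQ hf (fun q => ?_)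
      (e.surjective.comp hg) hs r (s ∘ₗ (e.restrictScalars R).symm.toLinearMap) hrf (fun x => ?_)
      (fun q => ?_), hsub⟩
    · simpa using hfg q
    · simp [hgs']
    · simp [hfr]

end Cores

/-! ### The duality `Hom(-, M)` between rigid modules and modules with finite coresolutions -/

/-- A module of relative dominant dimension at least two is reflexive. -/
theorem DomDimGE.isReflexive {R A C M : Type u} [CommRing R] [Ring A] [Ring C] [Algebra R C]
    [AddCommGroup M] [Module A M] [Module C M] [SMulCommClass C A M] (hAC : IsCentralizer A C M)
    {Y : Type u} [AddCommGroup Y] [Module C Y] (h : DomDimGE R C M Y 2) : IsReflexive A C M Y := by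
  obtain ⟨S, ⟨e⟩, hadd, ⟨hinj, hex⟩, -, hsurj, -⟩ := h
  exact ((hAC.isReflexive.of_inAdd (hadd 0 (by omega))).kernel
    (hAC.isReflexive.of_inAdd (hadd 1 (by omega))) (hinj (by omega)) (hex 0 (by omega))
    (hsurj (by omega))).of_equiv e.symm

section Main

variable {R A C M : Type u} [CommRing R] [Ring A] [Algebra R A] [Ring C] [Algebra R C]
  [AddCommGroup M] [Module R M] [Module A M] [Module C M] [IsScalarTower R A M]
  [SMulCommClass A C M] [SMulCommClass C A M]

variable (R A M) in
/-- `X` is finitely generated, `DM ⊗_A X ∈ R-proj` and `Tor_i^A(DM, X) = 0` for `i > 0`. -/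
structure IsTorRigid (X : Type u) [AddCommGroup X] [Module A X] : Prop where
  finite : Module.Finite A X
  fgProj : FGProj R (DualTensor R A M X)
  tor : ∀ i, Limits.IsZero (TorMod R A (StdDual R M) (i + 1) X)

theorem FGProj.isTorRigid {X : Type u} [AddCommGroup X] [Module A X] (hM : FGProj R M)
    (hX : FGProj A X) : IsTorRigid R A M X := by
  obtain ⟨_, _⟩ := id hX
  exact ⟨inferInstance, hM.dualTensor hX, isZero_torMod_of_projective R _⟩

theorem FGProj.dualTensor_of_equiv {X Y : Type u} [AddCommGroup X] [Module A X] [AddCommGroup Y]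
    [Module A Y] (h : FGProj R (DualTensor R A M X)) (e : X ≃ₗ[A] Y) :
    FGProj R (DualTensor R A M Y) := by
  refine h.of_retract (DualTensor.map R A M e.symm.toLinearMap)
    (DualTensor.map R A M e.toLinearMap) ?_
  rw [← BalTensor.map_comp, show e.toLinearMap ∘ₗ e.symm.toLinearMap = LinearMap.id by ext; simp,
    BalTensor.map_id]

theorem IsTorRigid.of_equiv {X Y : Type u} [AddCommGroup X] [Module A X] [AddCommGroup Y]
    [Module A Y] (h : IsTorRigid R A M X) (e : X ≃ₗ[A] Y) : IsTorRigid R A M Y where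
  finite := by
    have := h.finite
    exact Module.Finite.equiv e
  fgProj := h.fgProj.dualTensor_of_equiv e
  tor i := isZero_torMod_of_equiv R _ e (i + 1) (h.tor i)

/-- Dualising a finite `add M`-coresolution of `Y` gives a projective resolution of
`Hom_C(Y, M)`, which is therefore rigid. -/
theorem HasCores.dual (hM : FGProj R M) (hAC : IsCentralizer A C M) {k : ℕ} {Y : Type u}
    [AddCommGroup Y] [Module R Y] [Module C Y] [IsScalarTower R C Y] (h : HasCores R C M k Y) :
    IsReflexive A C M Y ∧ IsTorRigid R A M (Y →ₗ[C] M) ∧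
      HasProjectiveDimensionLE (ModuleCat.of A (Y →ₗ[C] M)) k := by
  induction k generalizing Y with
  | zero =>
    have hP : FGProj A (Y →ₗ[C] M) := fgProj_hom_of_inAdd hAC h
    exact ⟨hAC.isReflexive.of_inAdd h, hM.isTorRigid hP,
      hasProjectiveDimensionLE_zero_iff.2 hP.2⟩
  | succ k ih =>
    obtain ⟨Q, Z, _, _, _, _, _, _, _, _, f, g, hQ, hf, hfg, hg, hs, hZ⟩ := h
    obtain ⟨hZr, hZt, hZp⟩ := ih hZ
    have hP : FGProj A (Q →ₗ[C] M) := fgProj_hom_of_inAdd hAC hQ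
    have hQr : IsReflexive A C M Q := hAC.isReflexive.of_inAdd hQ
    obtain ⟨_, _⟩ := id hP
    have hex := homMap_exact (A := A) (M := M) hfg hg
    have hinj := homMap_injective (A := A) (M := M) hg
    have hsurj : Function.Surjective (homMap A M f) := hs
    have hs' : Function.Surjective
        (fun h : (Q →ₗ[C] M) →ₗ[A] M => h ∘ₗ homMap A M g) := fun ψ => by
      obtain ⟨z, hz⟩ := hZr.eval ψ
      obtain ⟨q, rfl⟩ := hg z
      exact ⟨hQr.equiv q, LinearMap.ext fun φ => (hz φ).symm⟩
    obtain ⟨hT, hTinj⟩ := hM.dualTensor_cokernel hP hex hsurj hZt.fgProj hs'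
    refine ⟨hQr.kernel hZr hf hfg hs, ⟨Module.Finite.of_surjective _ hsurj, hT, fun i => ?_⟩,
      (hasProjectiveDimensionLE_succ_iff hex hinj hsurj k).2 hZp⟩
    cases i with
    | zero => exact (isZero_torMod_one R (StdDual R M) hex hinj hsurj).2 hTinj
    | succ i => exact (isZero_torMod_shift R (StdDual R M) hex hinj hsurj i).2 (hZt.tor i)

theorem HasAddCores.isTorRigid (hM : FGProj R M) (hAC : IsCentralizer A C M) {k : ℕ}
    (h : HasAddCores R C M C k) : IsTorRigid R A M M :=
  (h.hasCores.dual hM hAC).2.1.of_equiv (LinearMap.ringLmapEquivSelf C A M)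

variable [IsScalarTower R C M]

/-- Dualising a finite projective resolution of a rigid reflexive module `X` into `M` gives an
`add M`-coresolution of `Hom_A(X, M)`. -/
theorem IsTorRigid.hasCores [IsNoetherianRing A] (hM : FGProj R M) (hAC : IsCentralizer A C M)
    {X : Type u} [AddCommGroup X] [Module A X] (hX : IsTorRigid R A M X)
    (hr : IsReflexive C A M X) (k : ℕ)
    (hk : HasProjectiveDimensionLE (ModuleCat.of A X) k) : HasCores R C M k (X →ₗ[A] M) := by
  induction k generalizing X with
  | zero =>
    rw [hasProjectiveDimensionLE_zero_iff] at hk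
    exact inAdd_hom_of_fgProj ⟨hX.finite, hk⟩
  | succ k ih =>
    have := hX.finite
    obtain ⟨t, g, hg⟩ := Module.Finite.exists_fin' A X
    have hP : FGProj A (Fin t → A) := FGProj.pi ⟨inferInstance, inferInstance⟩ t
    have hf : Function.Injective (LinearMap.ker g).subtype := Subtype.val_injective
    have hfg : Function.Exact (LinearMap.ker g).subtype g := g.exact_subtype_ker_map
    have hTf : Function.Injective (DualTensor.map R A M (LinearMap.ker g).subtype) :=
      (isZero_torMod_one R (StdDual R M) hfg hf hg).1 (hX.tor 0)
    obtain ⟨hTK, hs⟩ := hM.dualTensor_kernel hP hfg hg hX.fgProj hTf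
    have hK : IsTorRigid R A M (LinearMap.ker g) :=
      ⟨inferInstance, hTK, fun i =>
        (isZero_torMod_shift R (StdDual R M) hfg hf hg i).1 (hX.tor (i + 1))⟩
    have hPr : IsReflexive C A M (Fin t → A) :=
      hAC.isReflexive_self.of_inAdd ⟨t, LinearMap.id, LinearMap.id, rfl⟩
    have hKr : IsReflexive C A M (LinearMap.ker g) := hPr.kernel hr hf hfg hs
    refine ⟨(Fin t → A) →ₗ[A] M, LinearMap.ker g →ₗ[A] M, _, _, _, inferInstance, _, _, _,
      inferInstance, homMap C M g, homMap C M (LinearMap.ker g).subtype, inAdd_hom_of_fgProj hP,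
      homMap_injective hg, homMap_exact hfg hg, hs, fun ψ => ?_,
      ih hK hKr ((hasProjectiveDimensionLE_succ_iff hfg hf hg k).1 hk)⟩
    obtain ⟨x, hx⟩ := hr.eval ψ
    obtain ⟨p, rfl⟩ := hg x
    exact ⟨hPr.equiv p, LinearMap.ext fun φ => (hx φ).symm⟩

/-! ### Relative dominant dimension and projectivity of `DM ⊗ M` -/

/-- For a split copresentation `0 → A → M₁ → M₂`, the module `DM ⊗_C M` is the cokernel of the dual
`DM₂ → DM₁` of a regular map. -/
theorem DomDimGE.fgProj_dualTensor (hM : FGProj R M) (hCA : IsCentralizer C A M)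
    (h : DomDimGE R A M A 2) : FGProj R (DualTensor R C M M) := by
  obtain ⟨S, ⟨e⟩, hadd, ⟨hinj, hex⟩, ⟨h, -, hh⟩, hsurj, hhom⟩ := h
  have hP : ∀ i, i < 2 → FGProj C (S.X (i + 1) →ₗ[A] M) := fun i hi =>
    fgProj_hom_of_inAdd hCA (hadd i hi)
  have hr : ∀ i, i < 2 → IsReflexive C A M (S.X (i + 1)) := fun i hi =>
    hCA.isReflexive.of_inAdd (hadd i hi)
  let ε : ∀ i, i < 2 → S.X (i + 1) ≃ₗ[R] (DualTensor R C M (S.X (i + 1) →ₗ[A] M) →ₗ[R] R) :=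
    fun i hi => ((hr i hi).equiv.restrictScalars R).trans (homEquivDual hM)
  -- `d₁` is regular because it is part of a split sequence
  have hreg : IsRegularMap ((S.d 1).restrictScalars R) := ⟨h 1, fun x => by
    have h1 := congrArg (S.d 1) (hh 0 (by omega) x)
    rw [map_add, (hex 0 (by omega)).apply_apply_eq_zero, zero_add] at h1
    exact h1⟩
  have hreg' : IsRegularMap (DualTensor.map R C M (homMap C M (S.d 1))).dualMap :=
    hreg.conj (ε 0 (by omega)) (ε 1 (by omega)) fun x => by
      have hx : (hr 0 (by omega)).equiv x ∘ₗ homMap C M (S.d 1) =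
          (hr 1 (by omega)).equiv (S.d 1 x) := rfl
      have h2 := homToDual_comp (R := R) (homMap C M (S.d 1)) ((hr 0 (by omega)).equiv x)
      rw [hx] at h2
      exact h2.symm
  have hT : FGProj R (DualTensor R C M (S.X 0 →ₗ[A] M)) :=
    FGProj.of_isRegularMap (hM.dualTensor (hP 0 (by omega)))
      (BalTensor.map_exact R C (StdDual R M) (f := homMap C M (S.d 1)) (g := homMap C M (S.d 0))
        (hhom 0 (by omega)) (hsurj (by omega)))
      (BalTensor.map_surjective R C _ (hsurj (by omega)))
      (hreg'.of_dual (hM.dualTensor (hP 1 (by omega))) (hM.dualTensor (hP 0 (by omega))))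
  exact hT.dualTensor_of_equiv ((homCongr C M e).trans (LinearMap.ringLmapEquivSelf A C M))

/-- Applying `Hom_C(-, M)` to a finite free presentation of `M` over `C` gives the copresentation
of `A`; it splits because the cokernel `DM ⊗_C M` of its `R`-dual is projective. -/
theorem DomDimGE.of_fgProj_dualTensor [IsNoetherianRing C] [Module.Finite C M] (hM : FGProj R M)
    (hAC : IsCentralizer A C M) (hCA : IsCentralizer C A M) (h : FGProj R (DualTensor R C M M)) :
    DomDimGE R A M A 2 := by
  obtain ⟨t, g, hg⟩ := Module.Finite.exists_fin' C M
  obtain ⟨s, f', hf'⟩ := Module.Finite.exists_fin' C (LinearMap.ker g)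
  obtain ⟨f, hfg⟩ : ∃ f : (Fin s → C) →ₗ[C] (Fin t → C), Function.Exact f g := by
    refine ⟨(LinearMap.ker g).subtype ∘ₗ f', fun x => ⟨fun hx => ?_, ?_⟩⟩
    · obtain ⟨y, hy⟩ := hf' ⟨x, hx⟩
      exact ⟨y, congrArg Subtype.val hy⟩
    · rintro ⟨y, rfl⟩
      exact (f' y).2
  have hP : ∀ k, FGProj C (Fin k → C) := FGProj.pi ⟨inferInstance, inferInstance⟩
  have hPr : ∀ k, IsReflexive A C M (Fin k → C) := fun k =>
    hCA.isReflexive_self.of_inAdd ⟨k, LinearMap.id, LinearMap.id, rfl⟩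
  have hMr : IsReflexive A C M M := hAC.isReflexive
  have hinj := homMap_injective (A := A) (M := M) hg
  have hex := homMap_exact (A := A) (M := M) hfg hg
  have hreg : IsRegularMap ((homMap A M f).restrictScalars R) :=
    (isRegularMap_of_fgProj (hM.dualTensor (hP t)) h (BalTensor.map_exact R C (StdDual R M) hfg hg)
      (BalTensor.map_surjective R C _ hg)).dual.conj (homEquivDual hM).symm
        (homEquivDual hM).symm fun x => by
          obtain ⟨φ, rfl⟩ := (homEquivDual hM).surjective x
          rw [LinearEquiv.symm_apply_apply, LinearEquiv.eq_symm_apply]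
          exact homToDual_comp f φ
  obtain ⟨σ, hσ⟩ := hreg
  let d₀ := (homMap A M g).restrictScalars R
  have hker : ∀ x, x - σ (homMap A M f x) ∈ LinearMap.range d₀ := fun x =>
    (hex _).1 (by
      rw [map_sub]
      exact sub_eq_zero.2 (hσ x).symm)
  let q : ((Fin t → C) →ₗ[C] M) →ₗ[R] LinearMap.range d₀ :=
    (LinearMap.id - σ ∘ₗ (homMap A M f).restrictScalars R).codRestrict _ hker
  let r : ((Fin t → C) →ₗ[C] M) →ₗ[R] (M →ₗ[C] M) :=
    (LinearEquiv.ofInjective d₀ hinj).symm.toLinearMap ∘ₗ q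
  have hr : ∀ x, homMap A M g (r x) = x - σ (homMap A M f x) := fun x =>
    congrArg Subtype.val ((LinearEquiv.ofInjective d₀ hinj).apply_symm_apply (q x))
  obtain ⟨-, hcop⟩ := ModSeq.ofTwo_isAddCopres (M := M) (inAdd_hom_of_fgProj (hP t))
    (inAdd_hom_of_fgProj (hP s)) hex r σ
    (fun x => hinj (by rw [hr, hex.apply_apply_eq_zero, map_zero, sub_zero]))
    (fun y => by rw [hr, sub_add_cancel])
    (fun ψ => by
      obtain ⟨m, hm⟩ := hMr.eval ψ
      obtain ⟨c, rfl⟩ := hg m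
      exact ⟨(hPr t).equiv c, LinearMap.ext fun φ => (hm φ).symm⟩)
    (fun φ => by
      constructor
      · intro hφ
        obtain ⟨c, hc⟩ := (hPr t).eval φ
        have hgc : g c = 0 := hMr.sep _ _ fun h => by
          rw [map_zero]
          exact (hc (h ∘ₗ g)).symm.trans (LinearMap.congr_fun hφ h)
        obtain ⟨b, rfl⟩ := (hfg c).1 hgc
        exact ⟨(hPr s).equiv b, LinearMap.ext fun φ' => (hc φ').symm⟩
      · rintro ⟨ψ, rfl⟩
        refine LinearMap.ext fun x => ?_
        simp [hex.apply_apply_eq_zero])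
  exact ⟨_, ⟨hAC.equiv⟩, hcop⟩

/-- When `A` and `C` are each other's centralizers on `M`, the projective dimension of `M` over
`A` is at most `k` iff `C` has an `add M`-coresolution of length `k`. -/
theorem IsTorRigid.hasProjectiveDimensionLE_iff [IsNoetherianRing A] (hM : FGProj R M)
    (hAC : IsCentralizer A C M) (hCA : IsCentralizer C A M) (h : IsTorRigid R A M M) (k : ℕ) :
    HasProjectiveDimensionLE (ModuleCat.of A M) k ↔ HasAddCores R C M C k := by
  constructor
  · intro hk
    exact ((h.hasCores hM hAC hCA.isReflexive k hk).of_equiv hCA.equiv.symm).hasAddCores hM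
  · intro hk
    exact hasProjectiveDimensionLE_of_equiv (LinearMap.ringLmapEquivSelf C A M) k
      (hk.hasCores.dual hM hAC).2.2

end Main

/-! ### Passing between the two sides of a bimodule -/

theorem HasAddCores.congr {R C M Y Y' : Type u} [CommRing R] [Ring C] [Algebra R C]
    [AddCommGroup M] [Module C M] [AddCommGroup Y] [Module C Y] [AddCommGroup Y'] [Module C Y']
    (e : Y ≃ₗ[C] Y') {k : ℕ} (h : HasAddCores R C M Y k) : HasAddCores R C M Y' k := by
  obtain ⟨S, ⟨⟨e'⟩, hS⟩, h0⟩ := h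
  exact ⟨S, ⟨⟨e.symm.trans e'⟩, hS⟩, h0⟩

/-- The regular right `B`-module, as the regular module over the opposite ring. -/
def opRegularEquiv (B : Type u) [Ring B] : B ≃ₗ[Bᵐᵒᵖ] Bᵐᵒᵖ where
  toFun := op
  invFun := unop
  map_add' _ _ := rfl
  map_smul' _ _ := rfl
  left_inv _ := rfl
  right_inv _ := rfl

section Bimodule

variable {R A B M : Type u} [CommRing R] [IsNoetherianRing R] [Ring A] [Algebra R A] [Ring B]
  [Algebra R B] [AddCommGroup M] [Module R M] [Module A M] [Module Bᵐᵒᵖ M] [IsScalarTower R A M]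
  [IsScalarTower R Bᵐᵒᵖ M] [SMulCommClass A Bᵐᵒᵖ M] [SMulCommClass Bᵐᵒᵖ A M] {n : ℕ}

theorem FGProj.isNoetherianRing {R A : Type u} [CommRing R] [IsNoetherianRing R] [Ring A]
    [Algebra R A] (h : FGProj R A) : IsNoetherianRing A := by
  have := h.1
  exact isNoetherian_of_tower R (isNoetherian_of_isNoetherianRing_of_finite R A)

theorem FGProj.op {R B : Type u} [CommRing R] [Ring B] [Algebra R B] (h : FGProj R B) :
    FGProj R Bᵐᵒᵖ :=
  h.of_equiv (opLinearEquiv R).symm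

/-- The passage from quasi-generators to modules of finite projective dimension. -/
theorem IsQuasiGenerator.isLambda (hB : FGProj R B) (hAC : IsCentralizer A Bᵐᵒᵖ M)
    (h : IsQuasiGenerator R B M n) :
    IsCentralizer Bᵐᵒᵖ A M ∧ (LeftPair.mk (R := R) A M).IsLambda n := by
  obtain ⟨_, hM, hT, hn⟩ := h
  have hT' : FGProj R (DualTensor R Bᵐᵒᵖ M M) := (FGProj.balTensor_swap R fun _ _ => rfl).1 hT
  have hset : {k | HasAddCores R Bᵐᵒᵖ M B k} = {k | HasAddCores R Bᵐᵒᵖ M Bᵐᵒᵖ k} := by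
    ext k
    exact ⟨HasAddCores.congr (opRegularEquiv B), HasAddCores.congr (opRegularEquiv B).symm⟩
  rw [hset] at hn
  have hCA : IsCentralizer Bᵐᵒᵖ A M :=
    (DomDimGE.isReflexive hAC (HasAddCores.domDimGE hn.1)).isCentralizer
  have hA : FGProj R A := (hM.hom hT').of_equiv (hAC.equiv.restrictScalars R)
  have := hA.isNoetherianRing
  have := hB.op.isNoetherianRing
  have hrig : IsTorRigid R A M M := HasAddCores.isTorRigid hM hAC hn.1
  refine ⟨hCA, ⟨hA, hrig.finite, hM⟩, DomDimGE.of_fgProj_dualTensor hM hAC hCA hT', ?_,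
    hrig.fgProj, fun i hi => ?_⟩
  · have hset' : {k | HasProjectiveDimensionLE (ModuleCat.of A M) k} =
        {k | HasAddCores R Bᵐᵒᵖ M Bᵐᵒᵖ k} :=
      Set.ext fun k => hrig.hasProjectiveDimensionLE_iff hM hAC hCA k
    rw [← hset'] at hn
    exact hn
  · obtain ⟨i, rfl⟩ := Nat.exists_eq_succ_of_ne_zero hi.ne'
    exact hrig.tor i

/-- The passage from modules of finite projective dimension to quasi-generators. -/
theorem isQuasiGenerator_of_isLambda (hCA : IsCentralizer Bᵐᵒᵖ A M)
    (h : (LeftPair.mk (R := R) A M).IsLambda n) :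
    IsCentralizer A Bᵐᵒᵖ M ∧ FGProj R B ∧ IsQuasiGenerator R B M n := by
  obtain ⟨⟨hA, hfin, hM⟩, hdom, hpd, hT, htor⟩ := h
  have hAC : IsCentralizer A Bᵐᵒᵖ M := (DomDimGE.isReflexive hCA hdom).isCentralizer
  have hrig : IsTorRigid R A M M := ⟨hfin, hT, fun i => htor (i + 1) i.succ_pos⟩
  have := FGProj.isNoetherianRing hA
  have hC : FGProj R Bᵐᵒᵖ := (hM.hom hT).of_equiv (hCA.equiv.restrictScalars R)
  have _ := hM.1
  refine ⟨hAC, hC.of_equiv (opLinearEquiv R), Module.Finite.of_restrictScalars_finite R _ _, hM,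
    (FGProj.balTensor_swap R fun _ _ => rfl).2 (hdom.fgProj_dualTensor hM hCA), ?_⟩
  have hset : {k | HasAddCores R Bᵐᵒᵖ M B k} =
      {k | HasProjectiveDimensionLE (ModuleCat.of A M) k} := by
    ext k
    exact Iff.trans
      ⟨HasAddCores.congr (opRegularEquiv B), HasAddCores.congr (opRegularEquiv B).symm⟩
      (hrig.hasProjectiveDimensionLE_iff hM hAC hCA k).symm
  rw [hset]
  exact hpd

end Bimodule

/-! ### Isomorphisms of pairs -/

/-- The isomorphism of endomorphism algebras induced by a semilinear isomorphism of modules. -/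
def endAlgEquiv {R C C' M M' : Type u} [CommRing R] [Ring C] [Algebra R C] [Ring C']
    [Algebra R C'] [AddCommGroup M] [AddCommGroup M'] [Module R M] [Module R M'] [Module C M]
    [Module C' M'] [IsScalarTower R C M] [IsScalarTower R C' M']
    (φ : C → C') (hφ : Function.Surjective φ) (ψ : M ≃+ M')
    (hψ : ∀ c m, ψ (c • m) = φ c • ψ m) (hR : ∀ (r : R) m, ψ (r • m) = r • ψ m) :
    Module.End C M ≃ₐ[R] Module.End C' M' where
  toFun f :=
    { toFun := fun m => ψ (f (ψ.symm m))
      map_add' := fun x y => by simp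
      map_smul' := fun c m => by
        obtain ⟨c, rfl⟩ := hφ c
        have : ψ.symm (φ c • m) = c • ψ.symm m := by rw [AddEquiv.symm_apply_eq, hψ]; simp
        rw [this, f.map_smul, hψ, RingHom.id_apply] }
  invFun f :=
    { toFun := fun m => ψ.symm (f (ψ m))
      map_add' := fun x y => by simp
      map_smul' := fun c m => by
        rw [hψ, f.map_smul, AddEquiv.symm_apply_eq, RingHom.id_apply, hψ]; simp }
  left_inv f := by ext; simp
  right_inv f := by ext; simp
  map_mul' f g := by ext; simp
  map_add' f g := by ext; simp
  commutes' r := by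
    ext m
    change ψ (r • ψ.symm m) = r • m
    rw [hR, AddEquiv.apply_symm_apply]

theorem endAlgEquiv_apply {R C C' M M' : Type u} [CommRing R] [Ring C] [Algebra R C] [Ring C']
    [Algebra R C'] [AddCommGroup M] [AddCommGroup M'] [Module R M] [Module R M'] [Module C M]
    [Module C' M'] [IsScalarTower R C M] [IsScalarTower R C' M']
    (φ : C → C') (hφ : Function.Surjective φ) (ψ : M ≃+ M')
    (hψ : ∀ c m, ψ (c • m) = φ c • ψ m) (hR : ∀ (r : R) m, ψ (r • m) = r • ψ m)
    (f : Module.End C M) (m : M) : endAlgEquiv φ hφ ψ hψ hR f (ψ m) = ψ (f m) := by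
  change ψ (f (ψ.symm (ψ m))) = ψ (f m)
  rw [AddEquiv.symm_apply_apply]

/-- An algebra which acts on `M` as the full endomorphism ring over `C` is isomorphic to it. -/
noncomputable def IsCentralizer.algEquiv {R A C M : Type u} [CommRing R] [Ring A] [Algebra R A]
    [Ring C] [Algebra R C] [AddCommGroup M] [Module R M] [Module A M] [Module C M]
    [IsScalarTower R A M] [IsScalarTower R C M] [SMulCommClass C A M] (h : IsCentralizer A C M) :
    A ≃ₐ[R] Module.End C M :=
  AlgEquiv.ofBijective
    { toFun := fun a => h.equiv a
      map_one' := by ext m; exact one_smul A m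
      map_mul' := fun a b => by ext m; exact mul_smul a b m
      map_zero' := map_zero _
      map_add' := map_add _
      commutes' := fun r => by ext m; exact algebraMap_smul A r m } h.equiv.bijective

section Pairs

variable {R : Type u} [CommRing R]

theorem RightPair.Iso.phi {P P' : RightPair R} (h : P.Iso P') : (Phi P).Iso (Phi P') := by
  obtain ⟨φ, ψ, h⟩ := h
  have h' : ∀ (c : P.Bᵐᵒᵖ) m, ψ (c • m) = op (φ c.unop) • ψ m := fun c m => h c.unop m
  have hR : ∀ (r : R) m, ψ (r • m) = r • ψ m := fun r m => by
    rw [← algebraMap_smul P.Bᵐᵒᵖ r m, ← algebraMap_smul P'.Bᵐᵒᵖ r (ψ m), h']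
    simp [MulOpposite.algebraMap_apply]
  have hsurj : Function.Surjective fun c : P.Bᵐᵒᵖ => op (φ c.unop) := fun c =>
    ⟨op (φ.symm c.unop), by simp⟩
  exact ⟨endAlgEquiv _ hsurj ψ h' hR, ψ,
    fun f m => (endAlgEquiv_apply _ hsurj ψ h' hR f m).symm⟩

theorem LeftPair.Iso.psi {P P' : LeftPair R} (h : P.Iso P') : (Psi P).Iso (Psi P') := by
  obtain ⟨φ, ψ, h⟩ := h
  have hR : ∀ (r : R) m, ψ (r • m) = r • ψ m := fun r m => by
    rw [← algebraMap_smul P.A r m, ← algebraMap_smul P'.A r (ψ m), h]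
    simp
  exact ⟨AlgEquiv.op (endAlgEquiv φ φ.surjective ψ h hR), ψ,
    fun f m => (endAlgEquiv_apply φ φ.surjective ψ h hR f.unop m).symm⟩

theorem phi_isCentralizer (P : RightPair R) :
    IsCentralizer (Module.End P.Bᵐᵒᵖ P.M) P.Bᵐᵒᵖ P.M := fun f =>
  ⟨f, fun _ => rfl, fun _ hg => (LinearMap.ext hg).symm⟩

variable [IsNoetherianRing R]

theorem RightPair.IsGamma.isLambda {n : ℕ} {P : RightPair R} (h : P.IsGamma n) :
    IsCentralizer P.Bᵐᵒᵖ (Module.End P.Bᵐᵒᵖ P.M) P.M ∧ (Phi P).IsLambda n :=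
  h.2.isLambda h.1 (phi_isCentralizer P)

/-- `B` is recovered as the double centralizer of its action on `M`. -/
theorem RightPair.IsGamma.psi_phi_iso {n : ℕ} {P : RightPair R} (h : P.IsGamma n) :
    (Psi (Phi P)).Iso P := by
  refine RightPair.iso_equivalence.symm
    ⟨(AlgEquiv.opOp R P.B).trans (AlgEquiv.op (h.isLambda.1.algEquiv (R := R))),
      AddEquiv.refl _, fun b m => ?_⟩
  rfl

theorem LeftPair.IsLambda.isGamma {n : ℕ} {P : LeftPair R} (h : P.IsLambda n) :
    (Psi P).IsGamma n ∧ (Phi (Psi P)).Iso P := by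
  let : Module (Module.End P.A P.M)ᵐᵒᵖᵐᵒᵖ P.M := rightModuleOfLeft (Module.End P.A P.M) P.M
  have : IsScalarTower R (Module.End P.A P.M)ᵐᵒᵖᵐᵒᵖ P.M := ⟨fun _ _ _ => rfl⟩
  have : SMulCommClass P.A (Module.End P.A P.M)ᵐᵒᵖᵐᵒᵖ P.M :=
    ⟨fun a f m => (LinearMap.map_smul f.unop.unop a m).symm⟩
  have : SMulCommClass (Module.End P.A P.M)ᵐᵒᵖᵐᵒᵖ P.A P.M := SMulCommClass.symm _ _ _
  have hCA : IsCentralizer (Module.End P.A P.M)ᵐᵒᵖᵐᵒᵖ P.A P.M := fun f =>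
    ⟨op (op f), fun _ => rfl, fun _ hg =>
      unop_injective (unop_injective (LinearMap.ext hg).symm)⟩
  obtain ⟨hAC, hB, hQ⟩ := isQuasiGenerator_of_isLambda hCA h
  exact ⟨⟨hB, hQ⟩, LeftPair.iso_equivalence.symm
    ⟨hAC.algEquiv (R := R), AddEquiv.refl _, fun a m => rfl⟩⟩

end Pairs

/-! ### Self-orthogonality over a field -/

section Field

variable {R : Type u} [CommRing R]

/-- If every `R`-module is projective, `D` is exact and turns the maps `DM ⊗_A K → DM ⊗_A P` that
compute `Tor` into the maps `Hom_A(P, M) → Hom_A(K, M)` that compute `Ext`. -/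
theorem isZero_torMod_iff_subsingleton_ext {A M : Type u} [Ring A] [Algebra R A]
    [AddCommGroup M] [Module R M] [Module A M] [IsScalarTower R A M]
    (hR : ∀ (V : Type u) [AddCommGroup V] [Module R V], Module.Projective R V)
    (hM : FGProj R M) [IsNoetherianRing A] (i : ℕ) (X : Type u) [AddCommGroup X]
    [Module A X] [Module.Finite A X] :
    Limits.IsZero (TorMod R A (StdDual R M) (i + 1) X) ↔
      Subsingleton (Abelian.Ext (ModuleCat.of A X) (ModuleCat.of A M) (i + 1)) := by
  have hT : ∀ (Y : Type u) [AddCommGroup Y] [Module A Y] [Module.Finite A Y],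
      FGProj R (DualTensor R A M Y) := fun Y _ _ _ =>
    ⟨finite_balTensor R _ hM.stdDual, hR _⟩
  induction i generalizing X with
  | zero =>
    obtain ⟨t, g, hg⟩ := Module.Finite.exists_fin' A X
    have hP : FGProj A (Fin t → A) := FGProj.pi ⟨inferInstance, inferInstance⟩ t
    have hfg : Function.Exact (LinearMap.ker g).subtype g := g.exact_subtype_ker_map
    refine (isZero_torMod_one R (StdDual R M) hfg Subtype.val_injective hg).trans
      (Iff.trans ⟨fun h => ?_, fun h => ?_⟩
        (subsingleton_ext_one M hfg Subtype.val_injective hg).symm)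
    · exact (hM.dualTensor_kernel hP hfg hg (hT X) h).2
    · exact (hM.dualTensor_cokernel hP hfg hg (hT _) h).2
  | succ i ih =>
    obtain ⟨t, g, hg⟩ := Module.Finite.exists_fin' A X
    have hfg : Function.Exact (LinearMap.ker g).subtype g := g.exact_subtype_ker_map
    exact (isZero_torMod_shift R (StdDual R M) hfg Subtype.val_injective hg i).trans
      ((ih _).trans (subsingleton_ext_shift M hfg Subtype.val_injective hg i).symm)

theorem LeftPair.isDualTorRigid_iff_isSelfOrthogonal [IsNoetherianRing R] (hR : IsField R)
    (P : LeftPair R) (hP : P.IsLattice) : P.IsDualTorRigid ↔ P.IsSelfOrthogonal := by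
  have hproj : ∀ (V : Type u) [AddCommGroup V] [Module R V], Module.Projective R V := by
    let := hR.toField
    intro V _ _
    exact Module.Projective.of_free
  obtain ⟨hA, hfin, hM⟩ := hP
  have := FGProj.isNoetherianRing hA
  have hfin' : Module.Finite P.A P.M := hfin
  have key := fun i => isZero_torMod_iff_subsingleton_ext (A := P.A) hproj hM i P.M
  constructor
  · rintro ⟨-, h⟩ i hi
    obtain ⟨i, rfl⟩ := Nat.exists_eq_succ_of_ne_zero hi.ne'
    exact (key i).1 (h _ hi)
  · intro h
    refine ⟨⟨finite_balTensor R _ hM.stdDual, hproj _⟩, fun i hi => ?_⟩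
    obtain ⟨i, rfl⟩ := Nat.exists_eq_succ_of_ne_zero hi.ne'
    exact (key i).2 (h _ hi)

end Field

end QuasiGen

theorem theorem3p3 (R : Type u) [CommRing R] [IsNoetherianRing R] (n : ℕ) :
    (∃ e : QuasiGen.Gamma R n ≃ QuasiGen.Lambda R n,
      (∀ (P : QuasiGen.RightPair R) (h : P.IsGamma n),
        ∃ h' : (QuasiGen.Phi P).IsLambda n,
          e (QuasiGen.Gamma.mk P h) = QuasiGen.Lambda.mk (QuasiGen.Phi P) h') ∧
      (∀ (P : QuasiGen.LeftPair R) (h : P.IsLambda n),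
        ∃ h' : (QuasiGen.Psi P).IsGamma n,
          e.symm (QuasiGen.Lambda.mk P h) = QuasiGen.Gamma.mk (QuasiGen.Psi P) h')) ∧
    (IsField R → ∀ P : QuasiGen.LeftPair R, P.IsLattice →
      (P.IsDualTorRigid ↔ P.IsSelfOrthogonal)) := by
  refine ⟨⟨{
    toFun := Quotient.map' (fun P => ⟨QuasiGen.Phi P.1, P.2.isLambda.2⟩) fun _ _ h => h.phi
    invFun := Quotient.map' (fun P => ⟨QuasiGen.Psi P.1, P.2.isGamma.1⟩) fun _ _ h => h.psi
    left_inv := fun x => ?_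
    right_inv := fun x => ?_ }, fun P h => ⟨h.isLambda.2, rfl⟩, fun P h => ⟨h.isGamma.1, rfl⟩⟩,
    fun hR P hP => P.isDualTorRigid_iff_isSelfOrthogonal hR hP⟩
  · induction x using Quotient.inductionOn with
    | h P => exact Quotient.sound P.2.psi_phi_iso
  · induction x using Quotient.inductionOn with
    | h P => exact Quotient.sound P.2.isGamma.2
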